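/- There is a universal constant $C$ such that the following holds. Let $G=(V,E)$ be a finite simple undirected graph with $n$ vertices, edge costs $c:E\to\mathbb{R}_{\ge 0}$, a root $r\in V$ and treewidth at most $w$, where $w\ge 2$. Let $k\ge 1$, and let $S_1,\dots,S_h\subseteq V$ be groups with demands $k_1,\dots,k_h\le k$. Say that $F\subseteq E$ *satisfies* group $i$ if for some $v\in S_i$ there are $k_i$ pairwise edge-disjoint paths between $r$ and $v$ in $F$. Then there is a finite rooted tree $\widetilde{\mathcal T}$ with nonnegative edge costs, whose nodes are of two kinds, ordinary and connecting, which alternate along every edge, whose root and leaves are ordinary, together with groups $\widetilde S_1,\dots,\widetilde S_h$ of ordinary nodes, with the properties (i) and (ii) below. Here a subtree $X$ of $\widetilde{\mathcal T}$ is called *valid* if it contains the root, every ordinary node of $X$ that is not a leaf of $\widetilde{\mathcal T}$ has exactly one child in $X$, and every connecting node of $X$ has all its neighbours in $X$. Costs $c(F)$ and $c(X)$ are sums of edge costs. (i) $\widetilde{\mathcal T}$ has at most $n^{w^{Cwk}}$ nodes (that is, $n^{w^{O(wk)}}$). (ii) For every $F\subseteq E$ there is a valid subtree $X$, and for every valid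 subtree $X$ there is an $F\subseteq E$, such that $c(F)=c(X)$ and, for every $i\in\{1,\dots,h\}$, $F$ satisfies group $i$ if and only if $X$ connects the root of $\widetilde{\mathcal T}$ to some node of $\widetilde S_i$. -/

import Mathlib

open scoped NNReal

/-- A (finite) tree decomposition of a graph `G`: a finite tree whose nodes carry bags of vertices,
such that every vertex and every edge lies in some bag, and such that for every vertex the nodes
whose bags contain it induce a connected part of the tree. -/
structure TreeDecomposition {V : Type*} (G : SimpleGraph V) where
  /-- the nodes of the tree -/
  Node : Type
  finite : Finite Node
  /-- the tree -/
  tree : SimpleGraph Node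
  isTree : tree.IsTree
  /-- the bags -/
  bag : Node → Finset V
  vertex_mem : ∀ v, ∃ t, v ∈ bag t
  edge_mem : ∀ u v, G.Adj u v → ∃ t, u ∈ bag t ∧ v ∈ bag t
  bag_connected : ∀ v, (tree.induce {t | v ∈ bag t}).Preconnected

/-- The treewidth of `G`: the least `m` such that `G` has a tree decomposition all of whose bags
have at most `m + 1` vertices. -/
noncomputable def treewidth {V : Type*} (G : SimpleGraph V) : ℕ :=
  sInf {m : ℕ | ∃ D : TreeDecomposition G, ∀ t, (D.bag t).card ≤ m + 1}

/-- The edge set `F` contains `m` pairwise edge-disjoint paths between `r` and `v`. -/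
def EdgeConnects {V : Type*} (F : Finset (Sym2 V)) (m : ℕ) (r v : V) : Prop :=
  ∃ P : Fin m → (SimpleGraph.fromEdgeSet (F : Set (Sym2 V))).Path r v,
    Pairwise fun a b => (P a).1.edges.Disjoint (P b).1.edges

/-- A tree instance with `h` groups: a finite rooted tree with nonnegative edge costs, in which
ordinary nodes and connecting nodes alternate along every edge, the root and all the
leaves are ordinary nodes, and which carries `h` groups of ordinary nodes. -/
structure TreeInstance (h : ℕ) where
  /-- the nodes -/
  Node : Type
  finite : Finite Node
  /-- the tree -/
  tree : SimpleGraph Node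
  isTree : tree.IsTree
  root : Node
  /-- the connecting nodes; all other nodes are ordinary -/
  connecting : Set Node
  alternating : ∀ u v, tree.Adj u v → (u ∈ connecting ↔ v ∉ connecting)
  root_ordinary : root ∉ connecting
  connecting_not_leaf : ∀ v ∈ connecting,
    ∃ u, tree.Adj v u ∧ tree.dist root u = tree.dist root v + 1
  /-- the edge costs (only the values on edges of the tree matter) -/
  cost : Sym2 Node → ℝ≥0
  /-- the groups -/
  group : Fin h → Set Node
  group_ordinary : ∀ i, ∀ v ∈ group i, v ∉ connecting

namespace TreeInstance

variable {h : ℕ} (T : TreeInstance h)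

/-- `u` is a child of `v` in the rooted tree. -/
def IsChild (v u : T.Node) : Prop :=
  T.tree.Adj v u ∧ T.tree.dist T.root u = T.tree.dist T.root v + 1

/-- The accepted solutions: subtrees `X` that contain the root, in which every ordinary node of `X`
that is not a leaf of the whole tree has exactly one child in `X`, and every connecting node of `X`
has all its neighbours in `X`. -/
structure IsValid (X : T.tree.Subgraph) : Prop where
  connected : X.Connected
  root_mem : T.root ∈ X.verts
  ordinary : ∀ v ∈ X.verts, v ∉ T.connecting → (∃ u, T.IsChild v u) →
    ∃! u, T.IsChild v u ∧ X.Adj v u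
  connecting_full : ∀ v ∈ X.verts, v ∈ T.connecting → ∀ u, T.tree.Adj v u → X.Adj v u

/-- The total cost of the edges of a subtree. -/
noncomputable def subtreeCost (X : T.tree.Subgraph) : ℝ≥0 :=
  ∑ᶠ e ∈ X.edgeSet, T.cost e

/-- The subtree `X` connects the root to some node of the `i`-th group. -/
def ConnectsGroup (X : T.tree.Subgraph) (i : Fin h) : Prop :=
  ∃ t ∈ T.group i, ∃ p : T.tree.Walk T.root t, p.toSubgraph ≤ X

end TreeInstance

/-! Cut the graph recursively along balanced separators and let the tree record all choices made on
the way. A piece is an edge set `E'` with a small boundary `B` containing `r`. What the rest of the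
graph needs to know about a choice `F ⊆ E'` is its `profile`: which subsets of `B` are traces of
cuts with at most `j` edges of `F`, for each `j < k`. By Menger's theorem (`edgeConnects_iff_cut`)
the profile decides `m`-edge-connectivity between boundary vertices for every `m ≤ k`, and cuts can
be glued along boundaries, so that sets of equal profile are interchangeable inside any union
(`profile_union_congr`).

`Realizable` is the induction hypothesis: for every prescribed profile of the inside and every fixed
choice outside, some tree has exactly the inside choices of that profile as its solutions, labelled
with the groups satisfied at vertices of the piece. To join two pieces (`Realizable.union`), an
ordinary node guesses a pair of profiles and a connecting node below it keeps both subtrees. Each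
subtree is built against a representative of the other side's profile, hence the two can be solved
independently.

Pieces are split along bags of a tree decomposition, alternately halving the interior (up to a
constant factor) and the boundary. Boundaries thus stay of size `O(w)` and the depth is `O(log n)`.
There are at most `2 ^ (2 ^ b * k)` profiles on `b` vertices, and the logarithmic depth turns this
branching into a power of `n`. Abstract trees `RTree`, whose solutions are described by `RTree.Out`,
are converted to tree instances by `RTree.exists_treeInstance`. -/

/-! ### Menger's theorem for edges, by augmenting unit flows. -/

section Menger

open SimpleGraph

variable {V : Type*}

open Classical in
/-- The edges of `F` with exactly one end in `X`. -/
noncomputable def cutEdges (F : Finset (Sym2 V)) (X : Finset V) : Finset (Sym2 V) :=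
  F.filter fun e => ∃ x ∈ X, ∃ y ∉ X, e = s(x, y)

theorem mem_cutEdges {F : Finset (Sym2 V)} {X : Finset V} {e : Sym2 V} :
    e ∈ cutEdges F X ↔ e ∈ F ∧ ∃ x ∈ X, ∃ y ∉ X, e = s(x, y) := by
  simp [cutEdges]

/-- A set of darts is a unit flow in `F` if it uses every edge in at most one direction. -/
def IsUnitFlow (F : Finset (Sym2 V)) (D : Finset (V × V)) : Prop :=
  ∀ x y, (x, y) ∈ D → s(x, y) ∈ F ∧ x ≠ y ∧ (y, x) ∉ D

theorem IsUnitFlow.mono {F : Finset (Sym2 V)} {D D' : Finset (V × V)} (hD : IsUnitFlow F D)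
    (h : D' ⊆ D) : IsUnitFlow F D' := fun x y hxy =>
  ⟨(hD x y (h hxy)).1, (hD x y (h hxy)).2.1, fun h' => (hD x y (h hxy)).2.2 (h h')⟩

/-- The vertices reachable from `r` in `F` by a walk all of whose darts satisfy `Q`. -/
def dartReachable (F : Finset (Sym2 V)) (Q : V × V → Prop) (r : V) : Set V :=
  {u | ∃ p : (fromEdgeSet (F : Set (Sym2 V))).Walk r u, ∀ d ∈ p.darts, Q d.toProd}

theorem dartReachable_closed {F : Finset (Sym2 V)} {Q : V × V → Prop} {r x y : V}
    (hx : x ∈ dartReachable F Q r) (hxy : s(x, y) ∈ F) (hne : x ≠ y) (hQ : Q (x, y)) :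
    y ∈ dartReachable F Q r := by
  obtain ⟨p, hp⟩ := hx
  refine ⟨p.concat ((fromEdgeSet_adj _).2 ⟨by exact_mod_cast hxy, hne⟩), fun d hd => ?_⟩
  rw [Walk.darts_concat, List.concat_eq_append, List.mem_append, List.mem_singleton] at hd
  rcases hd with hd | rfl
  · exact hp d hd
  · exact hQ

theorem edgeConnects_self (F : Finset (Sym2 V)) (m : ℕ) (r : V) : EdgeConnects F m r r :=
  ⟨fun _ => Path.nil, fun _ _ _ e he => by simp [Path.nil] at he⟩

theorem edgeConnects_zero (F : Finset (Sym2 V)) (r v : V) : EdgeConnects F 0 r v :=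
  ⟨Fin.elim0, fun i => i.elim0⟩

variable [DecidableEq V]

/-- The net outflow of the unit flow `D` at `u`. -/
def excess (D : Finset (V × V)) (u : V) : ℤ :=
  ∑ p ∈ D, ((if p.1 = u then 1 else 0) - (if p.2 = u then 1 else 0))

theorem sum_excess (D : Finset (V × V)) (X : Finset V) :
    ∑ u ∈ X, excess D u =
      ∑ p ∈ D, ((if p.1 ∈ X then 1 else 0) - (if p.2 ∈ X then 1 else 0)) := by
  unfold excess
  rw [Finset.sum_comm]
  refine Finset.sum_congr rfl fun p _ => ?_
  rw [Finset.sum_sub_distrib, Finset.sum_ite_eq, Finset.sum_ite_eq]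

theorem excess_insert {D : Finset (V × V)} {x y : V} (h : (x, y) ∉ D) (u : V) :
    excess (insert (x, y) D) u =
      excess D u + (if x = u then 1 else 0) - (if y = u then 1 else 0) := by
  unfold excess
  rw [Finset.sum_insert h]
  ring

theorem excess_erase {D : Finset (V × V)} {x y : V} (h : (x, y) ∈ D) (u : V) :
    excess (D.erase (x, y)) u =
      excess D u - (if x = u then 1 else 0) + (if y = u then 1 else 0) := by
  unfold excess
  rw [Finset.sum_erase_eq_sub h]
  ring

/-- Each dart of the path cancels its reverse if that is in `D`, and is added otherwise; both change
the net outflows alike. A path does not return to `x`, so a dart just added is not met again. -/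
theorem IsUnitFlow.augment {F : Finset (Sym2 V)} {x z : V}
    (p : (fromEdgeSet (F : Set (Sym2 V))).Walk x z) :
    ∀ D : Finset (V × V), IsUnitFlow F D → p.IsPath → (∀ d ∈ p.darts, d.toProd ∉ D) →
      ∃ D', IsUnitFlow F D' ∧ ∀ u, excess D' u =
        excess D u + (if x = u then 1 else 0) - (if z = u then 1 else 0) := by
  induction p with
  | nil => intro D hD _ _; exact ⟨D, hD, fun u => by ring⟩
  | @cons x y z hxy p ih =>
    intro D hD hp hd
    rw [Walk.cons_isPath_iff] at hp
    have hadj := (fromEdgeSet_adj _).1 hxy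
    have hxyD : (x, y) ∉ D := hd ⟨(x, y), hxy⟩ (by simp)
    obtain ⟨D₁, hD₁, hsub, hex⟩ : ∃ D₁, IsUnitFlow F D₁ ∧ (∀ q ∈ D₁, q ∈ D ∨ q = (x, y)) ∧
        ∀ u, excess D₁ u =
          excess D u + (if x = u then 1 else 0) - (if y = u then 1 else 0) := by
      by_cases hyx : (y, x) ∈ D
      · refine ⟨D.erase (y, x), hD.mono (Finset.erase_subset _ _),
          fun q hq => Or.inl (Finset.mem_of_mem_erase hq), fun u => ?_⟩
        rw [excess_erase hyx]
        ring
      · refine ⟨insert (x, y) D, ?_, fun q hq => (Finset.mem_insert.1 hq).symm,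
          fun u => excess_insert hxyD u⟩
        intro a b hab
        rcases Finset.mem_insert.1 hab with h | h
        · obtain ⟨rfl, rfl⟩ := Prod.mk.inj h
          refine ⟨by exact_mod_cast hadj.1, hadj.2, fun h' => ?_⟩
          rcases Finset.mem_insert.1 h' with h' | h'
          · exact hadj.2 (Prod.mk.inj h').2
          · exact hyx h'
        · refine ⟨(hD a b h).1, (hD a b h).2.1, fun h' => ?_⟩
          rcases Finset.mem_insert.1 h' with h' | h'
          · obtain ⟨rfl, rfl⟩ := Prod.mk.inj h'
            exact hyx h
          · exact (hD a b h).2.2 h'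
    obtain ⟨D', hD', hex'⟩ := ih D₁ hD₁ hp.1 (fun d hdp hdD => by
      rcases hsub _ hdD with h | h
      · exact hd d (by simp [hdp]) h
      · have := p.dart_fst_mem_support_of_mem_darts hdp
        rw [h] at this
        exact hp.2 this)
    refine ⟨D', hD', fun u => ?_⟩
    rw [hex', hex]
    ring

/-- A unit flow uses each edge in one direction only, so deleting the darts of a path frees its
edges altogether. Paths found later in `D'` are therefore edge-disjoint from `p`. -/
theorem IsUnitFlow.remove_path {F : Finset (Sym2 V)} {x z : V}
    (p : (fromEdgeSet (F : Set (Sym2 V))).Walk x z) :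
    ∀ D : Finset (V × V), IsUnitFlow F D → p.IsPath → (∀ d ∈ p.darts, d.toProd ∈ D) →
      ∃ D' ⊆ D, (∀ a b, (a, b) ∈ D' → s(a, b) ∉ p.edges) ∧ ∀ u, excess D' u =
        excess D u - (if x = u then 1 else 0) + (if z = u then 1 else 0) := by
  induction p with
  | nil => intro D hD _ _; exact ⟨D, subset_rfl, by simp, fun u => by ring⟩
  | @cons x y z hxy p ih =>
    intro D hD hp hd
    rw [Walk.cons_isPath_iff] at hp
    have hxyD : (x, y) ∈ D := hd ⟨(x, y), hxy⟩ (by simp)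
    obtain ⟨D', hD', hedge, hex'⟩ := ih (D.erase (x, y)) (hD.mono (Finset.erase_subset _ _)) hp.1
      (fun d hdp => by
        refine Finset.mem_erase.2 ⟨fun h => ?_, hd d (by simp [hdp])⟩
        have := p.dart_fst_mem_support_of_mem_darts hdp
        rw [h] at this
        exact hp.2 this)
    refine ⟨D', hD'.trans (Finset.erase_subset _ _), fun a b hab => ?_, fun u => ?_⟩
    · rw [Walk.edges_cons, List.mem_cons, not_or]
      refine ⟨fun h => ?_, hedge a b hab⟩
      have hab' := Finset.mem_erase.1 (hD' hab)
      rcases Sym2.eq_iff.1 h with ⟨rfl, rfl⟩ | ⟨rfl, rfl⟩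
      · exact hab'.1 rfl
      · exact (hD _ _ hxyD).2.2 hab'.2
    · rw [hex', excess_erase hxyD]
      ring

theorem exists_path_of_dartReachable {F : Finset (Sym2 V)} {Q : V × V → Prop} {r v : V}
    (hv : v ∈ dartReachable F Q r) :
    ∃ p : (fromEdgeSet (F : Set (Sym2 V))).Walk r v, p.IsPath ∧ ∀ d ∈ p.darts, Q d.toProd := by
  obtain ⟨p, hp⟩ := hv
  exact ⟨p.bypass, p.bypass_isPath, fun d hd => hp d (p.darts_bypass_subset_darts hd)⟩

/-- Ford–Fulkerson: a dart along an edge of `F` that is not in `D` is residual. If residual darts do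
not lead to `v`, every edge leaving the reachable set is used outwards and none inwards, so the cut
has only `m` edges instead of the required `m + 1`. -/
theorem exists_unitFlow [Fintype V] {F : Finset (Sym2 V)} {r v : V} (hrv : r ≠ v) (m : ℕ)
    (hcut : ∀ X : Finset V, r ∈ X → v ∉ X → m ≤ (cutEdges F X).card) :
    ∃ D, IsUnitFlow F D ∧ excess D r = m ∧ ∀ u, u ≠ r → u ≠ v → excess D u = 0 := by
  classical
  induction m with
  | zero => exact ⟨∅, fun x y h => by simp at h, by simp [excess], fun u _ _ => by simp [excess]⟩
  | succ m ih =>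
    obtain ⟨D, hD, hr, h0⟩ := ih fun X h₁ h₂ => (Nat.le_succ m).trans (hcut X h₁ h₂)
    by_cases hv : v ∈ dartReachable F (· ∉ D) r
    · obtain ⟨p, hp, hpd⟩ := exists_path_of_dartReachable hv
      obtain ⟨D', hD', hex⟩ := hD.augment p D hp hpd
      refine ⟨D', hD', ?_, fun u hur huv => ?_⟩
      · rw [hex, if_pos rfl, if_neg hrv.symm, hr]
        push_cast
        ring
      · rw [hex, if_neg hur.symm, if_neg huv.symm, h0 u hur huv]
        ring
    · exfalso
      set X : Finset V := Finset.univ.filter (· ∈ dartReachable F (· ∉ D) r) with hX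
      have hmem : ∀ u, u ∈ X ↔ u ∈ dartReachable F (· ∉ D) r := fun u => by simp [hX]
      have hrX : r ∈ X := (hmem r).2 ⟨Walk.nil, by simp⟩
      have hvX : v ∉ X := fun h => hv ((hmem v).1 h)
      have hsum : ∑ u ∈ X, excess D u = m := by
        rw [Finset.sum_eq_single_of_mem r hrX, hr]
        intro u hu hur
        exact h0 u hur fun h => hvX (h ▸ hu)
      have hout : ∀ x ∈ X, ∀ y ∉ X, s(x, y) ∈ F → (x, y) ∈ D := by
        intro x hx y hy hxy
        by_contra hnot
        exact hy ((hmem y).2 (dartReachable_closed ((hmem x).1 hx) hxy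
          (fun h => hy (h ▸ hx)) hnot))
      have hsum' : ∑ u ∈ X, excess D u = (D.filter fun p => p.1 ∈ X ∧ p.2 ∉ X).card := by
        rw [sum_excess, Finset.card_filter, Nat.cast_sum]
        refine Finset.sum_congr rfl fun p hp => ?_
        by_cases h1 : p.1 ∈ X <;> by_cases h2 : p.2 ∈ X <;> simp [h1, h2]
        -- The case left is a dart of `D` entering `X`; its reverse leaves `X` and so is in `D` too,
        -- which a unit flow forbids.
        have hpD := hD p.1 p.2 hp
        exact hpD.2.2 (hout _ h2 _ h1 (Sym2.eq_swap ▸ hpD.1))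
      have hle : (cutEdges F X).card ≤ (D.filter fun p => p.1 ∈ X ∧ p.2 ∉ X).card := by
        refine (Finset.card_le_card ?_).trans
          (Finset.card_image_le (f := fun p : V × V => s(p.1, p.2)))
        intro e he
        obtain ⟨heF, x, hx, y, hy, rfl⟩ := mem_cutEdges.1 he
        exact Finset.mem_image.2 ⟨(x, y), Finset.mem_filter.2 ⟨hout x hx y hy heF, hx, hy⟩, rfl⟩
      have := hcut X hrX hvX
      have h3 : ((D.filter fun p => p.1 ∈ X ∧ p.2 ∉ X).card : ℤ) = m := hsum'.symm.trans hsum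
      omega

/-- Flow decomposition, one path at a time: if the darts of `D` did not lead to `v`, none would
leave the reachable set, whose net outflow would be at most `0` rather than `m + 1`. -/
theorem IsUnitFlow.exists_paths [Fintype V] {F : Finset (Sym2 V)} {r v : V} (hrv : r ≠ v)
    (m : ℕ) : ∀ D, IsUnitFlow F D → excess D r = m →
      (∀ u, u ≠ r → u ≠ v → excess D u = 0) →
      ∃ P : Fin m → (fromEdgeSet (F : Set (Sym2 V))).Path r v,
        (∀ i, ∀ d ∈ (P i).1.darts, d.toProd ∈ D) ∧
        Pairwise fun a b => (P a).1.edges.Disjoint (P b).1.edges := by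
  classical
  induction m with
  | zero => exact fun D _ _ _ => ⟨Fin.elim0, fun i => i.elim0, fun i => i.elim0⟩
  | succ m ih =>
    intro D hD hr h0
    have hv : v ∈ dartReachable F (· ∈ D) r := by
      by_contra hv
      set X : Finset V := Finset.univ.filter (· ∈ dartReachable F (· ∈ D) r) with hX
      have hmem : ∀ u, u ∈ X ↔ u ∈ dartReachable F (· ∈ D) r := fun u => by simp [hX]
      have hrX : r ∈ X := (hmem r).2 ⟨Walk.nil, by simp⟩
      have hvX : v ∉ X := fun h => hv ((hmem v).1 h)
      have hsum : ∑ u ∈ X, excess D u = (m + 1 : ℕ) := by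
        rw [Finset.sum_eq_single_of_mem r hrX, hr]
        intro u hu hur
        exact h0 u hur fun h => hvX (h ▸ hu)
      have hle : ∑ u ∈ X, excess D u ≤ 0 := by
        rw [sum_excess]
        refine Finset.sum_nonpos fun p hp => ?_
        by_cases h1 : p.1 ∈ X
        · have hpD := hD p.1 p.2 hp
          have h2 : p.2 ∈ X := (hmem _).2
            (dartReachable_closed ((hmem _).1 h1) hpD.1 hpD.2.1 hp)
          simp [h1, h2]
        · by_cases h2 : p.2 ∈ X <;> simp [h1, h2]
      rw [hsum] at hle
      push_cast at hle
      linarith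
    obtain ⟨p, hp, hpd⟩ := exists_path_of_dartReachable hv
    obtain ⟨D', hsub, hedge, hex⟩ := hD.remove_path p D hp hpd
    obtain ⟨P, hP, hdisj⟩ := ih D' (hD.mono hsub)
      (by rw [hex, if_pos rfl, if_neg hrv.symm, hr]; push_cast; ring)
      (fun u hur huv => by rw [hex, if_neg hur.symm, if_neg huv.symm, h0 u hur huv]; ring)
    have key : ∀ i, p.edges.Disjoint (P i).1.edges := by
      intro i e he he'
      obtain ⟨d, hd, rfl⟩ := List.mem_map.1 he'
      exact hedge d.fst d.snd (hP i d hd) he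
    refine ⟨Fin.cons ⟨p, hp⟩ P, fun i => ?_, fun i j hij => ?_⟩
    · refine Fin.cases ?_ (fun i => ?_) i
      · exact hpd
      · exact fun d hd => hsub (hP i d hd)
    · revert hij
      refine Fin.cases ?_ (fun i => ?_) i <;> refine Fin.cases ?_ (fun j => ?_) j
      · exact fun h => absurd rfl h
      · exact fun _ => key j
      · exact fun _ => (key i).symm
      · exact fun h => hdisj (ne_of_apply_ne Fin.succ h)

/-- Menger's theorem, edge version. -/
theorem edgeConnects_iff_cut [Fintype V] {F : Finset (Sym2 V)} {r v : V} (hrv : r ≠ v) (m : ℕ) :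
    EdgeConnects F m r v ↔
      ∀ X : Finset V, r ∈ X → v ∉ X → m ≤ (cutEdges F X).card := by
  constructor
  · rintro ⟨P, hP⟩ X hr hv
    have hex : ∀ i, ∃ e ∈ (P i).1.edges, e ∈ cutEdges F X := by
      intro i
      obtain ⟨d, hd, h1, h2⟩ := (P i).1.exists_boundary_dart (X : Set V) hr hv
      refine ⟨d.edge, List.mem_map.2 ⟨d, hd, rfl⟩, mem_cutEdges.2 ⟨?_, d.fst, h1, d.snd, h2, rfl⟩⟩
      exact_mod_cast ((fromEdgeSet_adj _).1 d.adj).1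
    choose f hf hfc using hex
    have hinj : Function.Injective f := by
      intro i j hij
      by_contra hne
      exact hP hne (hf i) (hij ▸ hf j)
    calc m = (Finset.univ.image f).card := by
          rw [Finset.card_image_of_injective _ hinj, Finset.card_univ, Fintype.card_fin]
      _ ≤ _ := Finset.card_le_card fun e he => by
          obtain ⟨i, _, rfl⟩ := Finset.mem_image.1 he
          exact hfc i
  · intro hcut
    obtain ⟨D, hD, hr, h0⟩ := exists_unitFlow hrv m hcut
    obtain ⟨P, _, hP⟩ := hD.exists_paths hrv m D hr h0
    exact ⟨P, hP⟩

end Menger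

/-! ### Labelled rooted trees and the outcomes of their solutions. -/

/-- A finite rooted tree whose nodes carry a cost (that of the edge to the parent) and a set of
labels; the children of a node are `child i` for `i < deg`. The tree `nil` has one node. -/
inductive RTree (h : ℕ) : Type
  | nil : RTree h
  | mk (lab : Set (Fin h)) (cost : ℝ≥0) (deg : ℕ) (child : ℕ → RTree h) : RTree h

namespace RTree

variable {h : ℕ}

def lab : RTree h → Set (Fin h)
  | nil => ∅
  | mk l _ _ _ => l

def cost : RTree h → ℝ≥0
  | nil => 0
  | mk _ c _ _ => c

def deg : RTree h → ℕ
  | nil => 0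
  | mk _ _ m _ => m

def child : RTree h → ℕ → RTree h
  | nil => fun _ => nil
  | mk _ _ _ f => f

/-- The number of nodes. -/
def size : RTree h → ℕ
  | nil => 1
  | mk _ _ m f => 1 + ∑ i ∈ Finset.range m, (f i).size

/-- The nodes, given by the sequences of child indices that lead to them from the root. -/
def nodes : RTree h → Finset (List ℕ)
  | nil => {[]}
  | mk _ _ m f =>
    insert [] ((Finset.range m).biUnion fun i => (f i).nodes.image (List.cons i))

/-- The subtree hanging from a node. -/
def sub : RTree h → List ℕ → RTree h
  | T, [] => T
  | T, i :: l => (T.child i).sub l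

/-- Connecting nodes (the root being ordinary iff `p`) have children and no labels. -/
def WF : RTree h → Bool → Prop
  | nil, p => p = true
  | mk l _ m f, p => (p = false → 0 < m ∧ l = ∅) ∧ ∀ i < m, (f i).WF (!p)

/-- The possible sets of children chosen at an ordinary (`true`) or connecting (`false`) node with
`m` children. -/
def Step (p : Bool) (m : ℕ) (J : Set ℕ) : Prop :=
  if p then 0 < m → ∃! x, x ∈ J else ∀ x < m, x ∈ J

/-- The pairs of a cost and a set of labels that are achieved by the solutions. -/
def Out : RTree h → Bool → Set (ℝ≥0 × Set (Fin h))
  | nil, _ => {(0, ∅)}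
  | mk l c m f, p => {o | ∃ (J : Finset ℕ) (g : ℕ → ℝ≥0 × Set (Fin h)),
      J ⊆ Finset.range m ∧ Step p m J ∧ (∀ i ∈ J, g i ∈ (f i).Out (!p)) ∧
      o = (c + ∑ i ∈ J, (g i).1, l ∪ ⋃ i ∈ J, (g i).2)}

theorem nil_mem_nodes (T : RTree h) : [] ∈ T.nodes := by
  cases T <;> simp [nodes]

theorem cons_mem_nodes {T : RTree h} {i : ℕ} {l : List ℕ} :
    i :: l ∈ T.nodes ↔ i < T.deg ∧ l ∈ (T.child i).nodes := by
  cases T <;> simp [nodes, deg, child]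

theorem concat_mem_nodes {T : RTree h} {l : List ℕ} {x : ℕ} :
    l ++ [x] ∈ T.nodes ↔ l ∈ T.nodes ∧ x < (T.sub l).deg := by
  induction l generalizing T with
  | nil => simp [cons_mem_nodes, nil_mem_nodes, sub]
  | cons i l ih => rw [List.cons_append, cons_mem_nodes, cons_mem_nodes, ih, sub, and_assoc]

theorem card_nodes_le (T : RTree h) : T.nodes.card ≤ T.size := by
  induction T with
  | nil => simp [nodes, size]
  | mk l c m f ih =>
    rw [nodes, size, add_comm]
    refine (Finset.card_insert_le _ _).trans (Nat.add_le_add_right ?_ 1)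
    exact Finset.card_biUnion_le.trans
      (Finset.sum_le_sum fun i _ => Finset.card_image_le.trans (ih i))

/-- The kind of the node `l` if the root has kind `p`. -/
def kind (p : Bool) (l : List ℕ) : Bool := if Even l.length then p else !p

theorem kind_cons (p : Bool) (i : ℕ) (l : List ℕ) : kind p (i :: l) = kind (!p) l := by
  unfold kind
  by_cases hl : Even l.length <;> simp [Nat.even_add_one, hl]

theorem WF.sub {T : RTree h} {p : Bool} (hT : T.WF p) {l : List ℕ} (hl : l ∈ T.nodes) :
    (T.sub l).WF (kind p l) := by
  induction l generalizing T p with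
  | nil => simpa [RTree.sub, kind] using hT
  | cons i l ih =>
    rw [cons_mem_nodes] at hl
    rw [kind_cons, RTree.sub]
    refine ih ?_ hl.2
    cases T
    · exact absurd hl.1 (Nat.not_lt_zero i)
    · exact hT.2 i hl.1

theorem WF.deg_pos {T : RTree h} (hT : T.WF false) : 0 < T.deg := by
  cases T
  · simp [WF] at hT
  · exact (hT.1 rfl).1

theorem WF.lab_eq {T : RTree h} (hT : T.WF false) : T.lab = ∅ := by
  cases T
  · rfl
  · exact (hT.1 rfl).2

/-- A set of nodes that contains the root, is closed under parents and makes admissible choices. -/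
structure IsSolution (T : RTree h) (p : Bool) (W : Finset (List ℕ)) : Prop where
  nil_mem : [] ∈ W
  subset : W ⊆ T.nodes
  of_concat : ∀ l x, l ++ [x] ∈ W → l ∈ W
  step : ∀ l ∈ W, Step (kind p l) (T.sub l).deg {x | l ++ [x] ∈ W}

/-- The nodes of `W` below the child `i` of the root. -/
noncomputable def branch (W : Finset (List ℕ)) (i : ℕ) : Finset (List ℕ) :=
  W.preimage (List.cons i) (List.cons_injective.injOn)

theorem mem_branch {W : Finset (List ℕ)} {i : ℕ} {l : List ℕ} :
    l ∈ branch W i ↔ i :: l ∈ W := by simp [branch]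

/-- The union of the root and of sets of nodes below the children in `J`. -/
def assemble (J : Finset ℕ) (W : ℕ → Finset (List ℕ)) : Finset (List ℕ) :=
  insert [] (J.biUnion fun i => (W i).image (List.cons i))

theorem nil_mem_assemble (J : Finset ℕ) (W : ℕ → Finset (List ℕ)) : [] ∈ assemble J W := by
  simp [assemble]

theorem cons_mem_assemble {J : Finset ℕ} {W : ℕ → Finset (List ℕ)} {i : ℕ} {l : List ℕ} :
    i :: l ∈ assemble J W ↔ i ∈ J ∧ l ∈ W i := by
  simp [assemble]

theorem IsSolution.branch {T : RTree h} {p : Bool} {W : Finset (List ℕ)} (hW : T.IsSolution p W)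
    {i : ℕ} (hi : [i] ∈ W) : (T.child i).IsSolution (!p) (branch W i) where
  nil_mem := mem_branch.2 hi
  subset l hl := (cons_mem_nodes.1 (hW.subset (mem_branch.1 hl))).2
  of_concat l x hl := mem_branch.2 (hW.of_concat (i :: l) x (mem_branch.1 hl))
  step l hl := by
    have := hW.step (i :: l) (mem_branch.1 hl)
    rw [kind_cons] at this
    simp only [mem_branch]
    exact this

theorem IsSolution.eq_assemble {T : RTree h} {p : Bool} {W : Finset (List ℕ)}
    (hW : T.IsSolution p W) :
    W = assemble ((Finset.range T.deg).filter fun i => [i] ∈ W) (RTree.branch W) := by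
  ext l
  cases l with
  | nil => simp [hW.nil_mem, nil_mem_assemble]
  | cons i l =>
    rw [cons_mem_assemble, mem_branch, Finset.mem_filter, Finset.mem_range]
    refine ⟨fun hl => ⟨⟨(cons_mem_nodes.1 (hW.subset hl)).1, ?_⟩, hl⟩, fun hl => hl.2⟩
    -- Closure under parents leads from `i :: l` back to `[i]`.
    induction l using List.reverseRecOn with
    | nil => exact hl
    | append_singleton l x ih => exact ih (hW.of_concat (i :: l) x hl)

theorem IsSolution.assemble {T : RTree h} {p : Bool} {J : Finset ℕ} {W : ℕ → Finset (List ℕ)}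
    (hJ : J ⊆ Finset.range T.deg) (hS : Step p T.deg J)
    (hW : ∀ i ∈ J, (T.child i).IsSolution (!p) (W i)) :
    T.IsSolution p (assemble J W) where
  nil_mem := nil_mem_assemble J W
  subset l hl := by
    cases l with
    | nil => exact nil_mem_nodes T
    | cons i l =>
      obtain ⟨hi, hl⟩ := cons_mem_assemble.1 hl
      exact cons_mem_nodes.2 ⟨Finset.mem_range.1 (hJ hi), (hW i hi).subset hl⟩
  of_concat l x hl := by
    cases l with
    | nil => exact nil_mem_assemble J W
    | cons i l =>
      obtain ⟨hi, hl⟩ := cons_mem_assemble.1 hl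
      exact cons_mem_assemble.2 ⟨hi, (hW i hi).of_concat l x hl⟩
  step l hl := by
    cases l with
    | nil =>
      have : {x | [] ++ [x] ∈ RTree.assemble J W} = (J : Set ℕ) := by
        ext x
        simp only [List.nil_append, Set.mem_ofPred_eq, cons_mem_assemble, Finset.mem_coe]
        exact ⟨fun hx => hx.1, fun hx => ⟨hx, (hW x hx).nil_mem⟩⟩
      rw [this]
      simpa [kind, sub] using hS
    | cons i l =>
      obtain ⟨hi, hl⟩ := cons_mem_assemble.1 hl
      have := (hW i hi).step l hl
      rw [kind_cons]
      simp only [List.cons_append, cons_mem_assemble, hi, true_and]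
      exact this

theorem sum_assemble (T : RTree h) (J : Finset ℕ) (W : ℕ → Finset (List ℕ)) :
    ∑ l ∈ assemble J W, (T.sub l).cost =
      T.cost + ∑ i ∈ J, ∑ l ∈ W i, ((T.child i).sub l).cost := by
  unfold assemble
  rw [Finset.sum_insert (by simp), Finset.sum_biUnion]
  · refine congrArg₂ _ rfl (Finset.sum_congr rfl fun i _ => ?_)
    rw [Finset.sum_image (List.cons_injective.injOn)]
    rfl
  · intro i _ j _ hij
    rw [Function.onFun, Finset.disjoint_left]
    intro l hl hl'
    obtain ⟨a, _, rfl⟩ := Finset.mem_image.1 hl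
    obtain ⟨b, _, hb⟩ := Finset.mem_image.1 hl'
    exact hij (List.cons.inj hb).1.symm

/-- The cost and the labels of a set of nodes. -/
def outcome (T : RTree h) (W : Finset (List ℕ)) : ℝ≥0 × Set (Fin h) :=
  (∑ l ∈ W, (T.sub l).cost, ⋃ l ∈ W, (T.sub l).lab)

theorem outcome_assemble (T : RTree h) (J : Finset ℕ) (W : ℕ → Finset (List ℕ)) :
    T.outcome (assemble J W) = (T.cost + ∑ i ∈ J, ((T.child i).outcome (W i)).1,
      T.lab ∪ ⋃ i ∈ J, ((T.child i).outcome (W i)).2) := by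
  unfold outcome
  rw [sum_assemble]
  refine Prod.ext rfl ?_
  ext g
  simp [assemble, sub]

/-- Passes from the recursive description, convenient for constructions, to sets of nodes, which are
what subtrees are. A solution is a choice of children of the root with one solution below each. -/
theorem mem_Out_iff {T : RTree h} {p : Bool} {o : ℝ≥0 × Set (Fin h)} :
    o ∈ T.Out p ↔ ∃ W, T.IsSolution p W ∧ T.outcome W = o := by
  induction T generalizing p o with
  | nil =>
    have hout : (nil : RTree h).outcome {[]} = (0, ∅) := by
      simp [outcome, sub, cost, lab]
    constructor
    · rintro rfl
      refine ⟨assemble ∅ fun _ => ∅, IsSolution.assemble (by simp) ?_ (by simp), ?_⟩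
      · cases p <;> simp [Step, deg]
      · simpa [assemble] using hout
    · rintro ⟨W, hW, rfl⟩
      rw [hW.eq_assemble]
      simpa [assemble, deg, Out] using hout
  | mk l c m f ih =>
    constructor
    · rintro ⟨J, g, hJ, hS, hg, rfl⟩
      have : ∀ i, ∃ W, i ∈ J → (f i).IsSolution (!p) W ∧ (f i).outcome W = g i := by
        intro i
        by_cases hi : i ∈ J
        · obtain ⟨W, hW⟩ := (ih i).1 (hg i hi)
          exact ⟨W, fun _ => hW⟩
        · exact ⟨∅, fun h => absurd h hi⟩
      choose W hW using this
      refine ⟨assemble J W, IsSolution.assemble hJ hS fun i hi => (hW i hi).1, ?_⟩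
      rw [outcome_assemble]
      refine Prod.ext ?_ ?_
      · exact congrArg (c + ·) (Finset.sum_congr rfl fun i hi => congrArg Prod.fst (hW i hi).2)
      · exact congrArg (l ∪ ·) (Set.iUnion₂_congr fun i hi => congrArg Prod.snd (hW i hi).2)
    · rintro ⟨W, hW, rfl⟩
      refine ⟨(Finset.range m).filter fun i => [i] ∈ W, fun i => (f i).outcome (branch W i),
        Finset.filter_subset _ _, ?_, fun i hi => (ih i).2 ⟨_, ?_, rfl⟩, ?_⟩
      · have := hW.step [] hW.nil_mem
        have h2 : {x | [] ++ [x] ∈ W} = (((Finset.range m).filter fun i => [i] ∈ W : Finset ℕ) :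
            Set ℕ) := by
          ext x
          simp only [List.nil_append, Set.mem_ofPred_eq, Finset.coe_filter, Finset.mem_range]
          exact ⟨fun hx => ⟨(cons_mem_nodes.1 (hW.subset hx)).1, hx⟩, fun hx => hx.2⟩
        rw [h2] at this
        exact this
      · exact hW.branch (Finset.mem_filter.1 hi).2
      · conv_lhs => rw [hW.eq_assemble, outcome_assemble]
        rfl

end RTree

/-! ### Tree instances from labelled trees. -/

namespace RTree

variable {h : ℕ}

/-- The tree of all finite sequences of numbers. -/
def listGraph : SimpleGraph (List ℕ) where
  Adj u v := (∃ x, v = u ++ [x]) ∨ ∃ x, u = v ++ [x]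
  symm := ⟨fun _ _ h => h.symm⟩
  loopless := ⟨fun u hu => by
    rcases hu with ⟨x, hx⟩ | ⟨x, hx⟩ <;> simpa using congrArg List.length hx⟩

theorem listGraph_adj_concat (l : List ℕ) (x : ℕ) : listGraph.Adj l (l ++ [x]) := Or.inl ⟨x, rfl⟩

theorem listGraph_crossing {l a b : List ℕ} {x : ℕ} (hab : listGraph.Adj a b)
    (ha : l ++ [x] <+: a) (hb : ¬ l ++ [x] <+: b) : a = l ++ [x] ∧ b = l := by
  rcases hab with ⟨y, rfl⟩ | ⟨y, rfl⟩
  · exact absurd (ha.trans (List.prefix_append _ _)) hb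
  · rcases List.prefix_concat_iff.1 ha with h1 | h1
    · exact ⟨h1.symm, (List.append_inj' h1 rfl).1.symm⟩
    · exact absurd h1 hb

theorem not_concat_prefix (l : List ℕ) (x : ℕ) : ¬ l ++ [x] <+: l := fun hl => by
  simpa using hl.length_le

/-- The edge from `l` to `l ++ [x]` is a bridge: no other edge joins an extension of `l ++ [x]` to a
sequence that is not one. -/
theorem listGraph_isAcyclic : listGraph.IsAcyclic := by
  rw [SimpleGraph.isAcyclic_iff_forall_adj_isBridge]
  suffices H : ∀ l x, listGraph.IsBridge s(l, l ++ [x]) by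
    rintro u v (⟨x, rfl⟩ | ⟨x, rfl⟩)
    · exact H u x
    · rw [Sym2.eq_swap]; exact H v x
  intro l x
  rw [SimpleGraph.isBridge_iff]
  rintro ⟨p⟩
  obtain ⟨d, -, h1, h2⟩ := p.reverse.exists_boundary_dart {a | l ++ [x] <+: a}
    (List.prefix_refl _) (not_concat_prefix l x)
  have hadj := d.adj
  rw [SimpleGraph.deleteEdges_adj] at hadj
  obtain ⟨h3, h4⟩ := listGraph_crossing hadj.1 h1 h2
  exact hadj.2 (by rw [h3, h4, Sym2.eq_swap]; rfl)

/-- The tree on the nodes of `T`. -/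
def graph (T : RTree h) : SimpleGraph {l // l ∈ T.nodes} :=
  listGraph.comap Subtype.val

/-- The root as a node of `T.graph`. -/
def rootNode (T : RTree h) : {l // l ∈ T.nodes} := ⟨[], T.nil_mem_nodes⟩

theorem length_le_of_walk {T : RTree h} {u v : {l // l ∈ T.nodes}} (p : T.graph.Walk u v) :
    v.1.length ≤ u.1.length + p.length := by
  induction p with
  | nil => simp
  | @cons u v w huv p ih =>
    have : v.1.length ≤ u.1.length + 1 := by
      rcases huv with ⟨x, hx⟩ | ⟨x, hx⟩ <;> rw [hx] <;> simp
      omega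
    rw [SimpleGraph.Walk.length_cons]
    omega

theorem exists_walk_length (T : RTree h) (l : List ℕ) (hl : l ∈ T.nodes) :
    ∃ p : T.graph.Walk T.rootNode ⟨l, hl⟩, p.length = l.length := by
  induction l using List.reverseRecOn with
  | nil => exact ⟨SimpleGraph.Walk.nil, rfl⟩
  | append_singleton l x ih =>
    obtain ⟨p, hp⟩ := ih (concat_mem_nodes.1 hl).1
    refine ⟨p.concat (show T.graph.Adj _ _ from listGraph_adj_concat l x), ?_⟩
    rw [SimpleGraph.Walk.length_concat, hp, List.length_append, List.length_singleton]

theorem graph_connected (T : RTree h) : T.graph.Connected := by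
  have : Nonempty {l // l ∈ T.nodes} := ⟨T.rootNode⟩
  refine SimpleGraph.Connected.mk fun u v => ?_
  obtain ⟨p, _⟩ := T.exists_walk_length u.1 u.2
  obtain ⟨q, _⟩ := T.exists_walk_length v.1 v.2
  exact ⟨p.reverse.append q⟩

theorem graph_isTree (T : RTree h) : T.graph.IsTree where
  connected := T.graph_connected
  isAcyclic := listGraph_isAcyclic.comap ⟨Subtype.val, fun h => h⟩ Subtype.val_injective

theorem dist_root (T : RTree h) (v : {l // l ∈ T.nodes}) :
    T.graph.dist T.rootNode v = v.1.length := by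
  obtain ⟨p, hp⟩ := T.exists_walk_length v.1 v.2
  obtain ⟨q, hq⟩ := T.graph_connected.exists_walk_length_eq_dist T.rootNode v
  refine le_antisymm (hp ▸ SimpleGraph.dist_le p) ?_
  rw [← hq]
  simpa [rootNode] using length_le_of_walk q

/-- The tree instance given by a well-formed tree. -/
noncomputable abbrev toInstance (T : RTree h) (hT : T.WF true) : TreeInstance h where
  Node := {l // l ∈ T.nodes}
  finite := inferInstance
  tree := T.graph
  isTree := T.graph_isTree
  root := T.rootNode
  connecting := {v | kind true v.1 = false}
  alternating u v huv := by
    rcases huv with ⟨x, hx⟩ | ⟨x, hx⟩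
    · by_cases hu : Even u.1.length <;> simp [kind, hx, hu, Nat.even_add_one, -Nat.not_even_iff_odd]
    · by_cases hu : Even v.1.length <;> simp [kind, hx, hu, Nat.even_add_one, -Nat.not_even_iff_odd]
  root_ordinary := by simp [kind, rootNode]
  connecting_not_leaf v hv := by
    have h1 := hT.sub v.2
    rw [show kind true v.1 = false from hv] at h1
    have h2 : v.1 ++ [0] ∈ T.nodes := concat_mem_nodes.2 ⟨v.2, h1.deg_pos⟩
    refine ⟨⟨_, h2⟩, listGraph_adj_concat v.1 0, ?_⟩
    rw [dist_root, dist_root, List.length_append, List.length_singleton]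
  -- An edge costs what its deeper end stores; ends of equal depth are never adjacent, and the value
  -- `0` there only completes the symmetric definition.
  cost := Sym2.lift ⟨fun u v => if u.1.length < v.1.length then (T.sub v.1).cost else
    if v.1.length < u.1.length then (T.sub u.1).cost else 0, fun u v => by
      rcases lt_trichotomy u.1.length v.1.length with h1 | h1 | h1
      · simp [h1, h1.le]
      · simp [h1]
      · simp [h1, h1.le]⟩
  group i := {v | i ∈ (T.sub v.1).lab}
  group_ordinary i v hv hc := by
    have h1 := hT.sub v.2
    rw [show kind true v.1 = false from hc] at h1
    rw [Set.mem_ofPred_eq, h1.lab_eq] at hv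
    exact hv

section Instance

variable {T : RTree h} {hT : T.WF true}

theorem card_toInstance : Nat.card (T.toInstance hT).Node ≤ T.size := by
  refine le_trans (le_of_eq ?_) T.card_nodes_le
  exact (Nat.card_eq_fintype_card (α := {l // l ∈ T.nodes})).trans (Fintype.card_coe _)

theorem mem_connecting {v : {l // l ∈ T.nodes}} :
    v ∈ (T.toInstance hT).connecting ↔ kind true v.1 = false := Iff.rfl

theorem isChild_iff {v u : {l // l ∈ T.nodes}} :
    (T.toInstance hT).IsChild v u ↔ ∃ x, u.1 = v.1 ++ [x] := by
  constructor
  · rintro ⟨h1 | ⟨x, hx⟩, h2⟩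
    · exact h1
    · have h3 : u.1.length = v.1.length + 1 := by
        rw [← dist_root, ← dist_root]; exact h2
      rw [hx] at h3
      simp at h3
      omega
  · rintro ⟨x, hx⟩
    refine ⟨Or.inl ⟨x, hx⟩, ?_⟩
    have h3 : u.1.length = v.1.length + 1 := by rw [hx]; simp
    rw [← dist_root, ← dist_root] at h3
    exact h3

/-- A walk in `X` from `u` to the root has to leave the set of extensions of `u`, which only the
edge from `u` to its parent does. -/
theorem adj_of_concat_mem {X : T.graph.Subgraph} (hX : X.Connected) (hr : T.rootNode ∈ X.verts)
    {v u : {l // l ∈ T.nodes}} {x : ℕ} (hu : u ∈ X.verts) (hux : u.1 = v.1 ++ [x]) :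
    X.Adj v u := by
  obtain ⟨p⟩ := hX.preconnected ⟨u, hu⟩ ⟨T.rootNode, hr⟩
  obtain ⟨d, -, h1, h2⟩ := p.exists_boundary_dart {a | v.1 ++ [x] <+: a.1.1}
    (by rw [Set.mem_ofPred_eq, hux])
    (fun hn => by simpa [rootNode] using List.IsPrefix.length_le hn)
  have hadj : X.Adj d.fst.1 d.snd.1 := d.adj
  obtain ⟨h3, h4⟩ := listGraph_crossing (X.adj_sub hadj) h1 h2
  rw [show d.fst.1 = u from Subtype.ext (h3.trans hux.symm),
    show d.snd.1 = v from Subtype.ext h4] at hadj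
  exact hadj.symm

/-- The nodes of a subgraph of `T.graph`. -/
noncomputable def vertexLists (X : T.graph.Subgraph) : Finset (List ℕ) :=
  X.verts.toFinite.toFinset.map (Function.Embedding.subtype _)

theorem mem_vertexLists {X : T.graph.Subgraph} {l : List ℕ} :
    l ∈ vertexLists X ↔ ∃ hl : l ∈ T.nodes, ⟨l, hl⟩ ∈ X.verts := by
  simp [vertexLists]

theorem isSolution_vertexLists {X : T.graph.Subgraph} (hX : (T.toInstance hT).IsValid X) :
    T.IsSolution true (vertexLists X) where
  nil_mem := mem_vertexLists.2 ⟨T.nil_mem_nodes, hX.root_mem⟩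
  subset l hl := (mem_vertexLists.1 hl).1
  of_concat l x hl := by
    obtain ⟨h1, h2⟩ := mem_vertexLists.1 hl
    exact mem_vertexLists.2 ⟨(concat_mem_nodes.1 h1).1,
      (adj_of_concat_mem hX.connected hX.root_mem (v := ⟨l, _⟩) h2 rfl).fst_mem⟩
  step l hl := by
    obtain ⟨hlN, hlX⟩ := mem_vertexLists.1 hl
    unfold Step
    split_ifs with hk
    · intro hdeg
      obtain ⟨u, ⟨⟨hu1, hu2⟩, hu3⟩⟩ := hX.ordinary ⟨l, hlN⟩ hlX
        (fun hc => by rw [mem_connecting] at hc; simp [hk] at hc)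
        ⟨⟨l ++ [0], concat_mem_nodes.2 ⟨hlN, hdeg⟩⟩, isChild_iff.2 ⟨0, rfl⟩⟩
      obtain ⟨x, hx⟩ := isChild_iff.1 hu1
      refine ⟨x, ?_, fun y hy => ?_⟩
      · change l ++ [x] ∈ vertexLists X
        rw [← show u.1 = l ++ [x] from hx]
        exact mem_vertexLists.2 ⟨u.2, hu2.snd_mem⟩
      · obtain ⟨h1, h2⟩ := mem_vertexLists.1 hy
        have h3 := hu3 ⟨l ++ [y], h1⟩ ⟨isChild_iff.2 ⟨y, rfl⟩,
          adj_of_concat_mem hX.connected hX.root_mem h2 rfl⟩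
        have h4 : l ++ [y] = l ++ [x] := (congrArg Subtype.val h3).trans hx
        simpa using h4
    · intro x hx
      have h1 : l ++ [x] ∈ T.nodes := concat_mem_nodes.2 ⟨hlN, hx⟩
      exact mem_vertexLists.2 ⟨h1, (hX.connecting_full ⟨l, hlN⟩ hlX
        (mem_connecting.2 (by simpa using hk))
        ⟨_, h1⟩ (listGraph_adj_concat l x)).snd_mem⟩

theorem isValid_of_isSolution {W : Finset (List ℕ)} (hW : T.IsSolution true W) :
    ∃ X : T.graph.Subgraph, (T.toInstance hT).IsValid X ∧ vertexLists X = W := by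
  let X : T.graph.Subgraph := (⊤ : T.graph.Subgraph).induce {v | v.1 ∈ W}
  have hmem : ∀ v, v ∈ X.verts ↔ v.1 ∈ W := fun v => Iff.rfl
  have hadj : ∀ u v, X.Adj u v ↔ u.1 ∈ W ∧ v.1 ∈ W ∧ T.graph.Adj u v := fun u v => by
    simp [X]
  refine ⟨X, ⟨?_, hW.nil_mem, ?_, ?_⟩, ?_⟩
  · have hreach : ∀ (l : List ℕ) (hl : l ∈ T.nodes) (hlW : l ∈ W),
        X.coe.Reachable ⟨T.rootNode, hW.nil_mem⟩ ⟨⟨l, hl⟩, hlW⟩ := by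
      intro l
      induction l using List.reverseRecOn with
      | nil => exact fun _ _ => SimpleGraph.Reachable.refl _
      | append_singleton l x ih =>
        intro hl hlW
        have h1 := hW.of_concat l x hlW
        refine (ih (hW.subset h1) h1).trans (SimpleGraph.Adj.reachable ?_)
        exact (hadj _ _).2 ⟨h1, hlW, listGraph_adj_concat l x⟩
    constructor
    exact (SimpleGraph.connected_iff _).2 ⟨fun u v =>
      (hreach u.1.1 u.1.2 u.2).symm.trans (hreach v.1.1 v.1.2 v.2),
      ⟨⟨T.rootNode, hW.nil_mem⟩⟩⟩
  · intro v hv hk hc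
    obtain ⟨u, hu⟩ := hc
    obtain ⟨x, hx⟩ := isChild_iff.1 hu
    have hs := hW.step v.1 hv
    have hk' : kind true v.1 = true := by
      rw [mem_connecting] at hk
      simpa using hk
    unfold Step at hs
    rw [if_pos hk'] at hs
    have hxN : v.1 ++ [x] ∈ T.nodes := hx ▸ u.2
    obtain ⟨y, hy, hy'⟩ := hs ((Nat.zero_le x).trans_lt (concat_mem_nodes.1 hxN).2)
    refine ⟨⟨v.1 ++ [y], hW.subset hy⟩, ⟨isChild_iff.2 ⟨y, rfl⟩,
      (hadj _ _).2 ⟨hv, hy, listGraph_adj_concat v.1 y⟩⟩, ?_⟩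
    rintro z ⟨hz1, hz2⟩
    obtain ⟨w, hw⟩ := isChild_iff.1 hz1
    have hw' : v.1 ++ [w] ∈ W := by
      rw [← hw]
      exact ((hadj _ _).1 hz2).2.1
    refine Subtype.ext ?_
    rw [hw, hy' w hw']
  · intro v hv hk u hvu
    refine (hadj _ _).2 ⟨hv, ?_, hvu⟩
    have hs := hW.step v.1 hv
    have hk' : ¬ kind true v.1 = true := by
      rw [mem_connecting] at hk
      simp [hk]
    unfold Step at hs
    rw [if_neg hk'] at hs
    rcases hvu with ⟨x, hx⟩ | ⟨x, hx⟩
    · rw [hx]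
      exact hs x (concat_mem_nodes.1 (hx ▸ u.2)).2
    · have h1 : v.1 ∈ W := hv
      rw [hx] at h1
      exact hW.of_concat _ _ h1
  · ext l
    rw [mem_vertexLists]
    exact ⟨fun ⟨_, hl⟩ => hl, fun hl => ⟨hW.subset hl, hl⟩⟩

/-- The edges of a valid subtree correspond to its nodes other than the root, each joined to its
parent. The root has no such edge, hence `h0`. -/
theorem subtreeCost_eq (h0 : T.cost = 0) {X : T.graph.Subgraph}
    (hX : (T.toInstance hT).IsValid X) :
    (T.toInstance hT).subtreeCost X = (T.outcome (vertexLists X)).1 := by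
  let par : {l // l ∈ T.nodes} → {l // l ∈ T.nodes} := fun v => ⟨v.1.dropLast, by
    rcases List.eq_nil_or_concat v.1 with h1 | ⟨l, x, h1⟩
    · simp [h1, nil_mem_nodes]
    · have := v.2
      rw [h1, List.concat_eq_append] at this
      simpa [h1] using (concat_mem_nodes.1 this).1⟩
  have hpar : ∀ u v x, u.1 = v.1 ++ [x] → par u = v := fun u v x hx =>
    Subtype.ext (by simp [par, hx])
  have hlen : ∀ u : {l // l ∈ T.nodes}, u.1 ≠ [] → (par u).1.length < u.1.length := by
    intro u hu
    have := List.length_pos_iff.2 hu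
    simp only [par, List.length_dropLast]
    omega
  have hedge : X.edgeSet = (fun u => s(par u, u)) '' {u | u ∈ X.verts ∧ u.1 ≠ []} := by
    ext e
    induction e using Sym2.ind with
    | _ a b =>
    rw [SimpleGraph.Subgraph.mem_edgeSet]
    constructor
    · intro hab
      rcases X.adj_sub hab with ⟨x, hx⟩ | ⟨x, hx⟩
      · exact ⟨b, ⟨hab.snd_mem, by simp [hx]⟩, by simp only [hpar b a x hx]⟩
      · exact ⟨a, ⟨hab.fst_mem, by simp [hx]⟩, by simp only [hpar a b x hx, Sym2.eq_swap]⟩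
    · rintro ⟨u, ⟨hu1, hu2⟩, hu3⟩
      have : X.Adj (par u) u := by
        obtain h1 | ⟨l, x, h1⟩ := List.eq_nil_or_concat u.1
        · exact absurd h1 hu2
        · refine adj_of_concat_mem hX.connected hX.root_mem (x := x) hu1 ?_
          simp [par, h1]
      rw [← SimpleGraph.Subgraph.mem_edgeSet, ← hu3]
      exact this
  have hinj : Set.InjOn (fun u => s(par u, u)) {u | u ∈ X.verts ∧ u.1 ≠ []} := by
    rintro u ⟨_, hu⟩ v ⟨_, hv⟩ huv
    rcases Sym2.eq_iff.1 huv with ⟨_, h1⟩ | ⟨h1, h2⟩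
    · exact h1
    · have h3 := hlen u hu
      have h4 := hlen v hv
      rw [h1] at h3
      rw [← h2] at h4
      omega
  have hcost : ∀ u, u.1 ≠ [] → (T.toInstance hT).cost s(par u, u) = (T.sub u.1).cost := by
    intro u hu
    simp only [toInstance, Sym2.lift_mk]
    rw [if_pos (hlen u hu)]
  unfold TreeInstance.subtreeCost outcome
  rw [hedge, finsum_mem_image hinj]
  rw [finsum_mem_congr rfl fun u hu => hcost u hu.2]
  have h1 : ((vertexLists X).erase [] : Finset (List ℕ)) =
      (Subtype.val '' {u : {l // l ∈ T.nodes} | u ∈ X.verts ∧ u.1 ≠ []} : Set (List ℕ)) := by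
    ext l
    rw [Finset.mem_coe, Finset.mem_erase, mem_vertexLists]
    constructor
    · rintro ⟨h1, h2, h3⟩
      exact ⟨⟨l, h2⟩, ⟨h3, h1⟩, rfl⟩
    · rintro ⟨u, ⟨h1, h2⟩, rfl⟩
      exact ⟨h2, u.2, h1⟩
  have h2 : [] ∈ vertexLists X := (isSolution_vertexLists hX).nil_mem
  rw [← Finset.add_sum_erase _ _ h2, ← finsum_mem_coe_finset, h1,
    finsum_mem_image Subtype.val_injective.injOn]
  simp [sub, h0]

theorem connectsGroup_iff {X : T.graph.Subgraph} (hX : (T.toInstance hT).IsValid X) (i : Fin h) :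
    (T.toInstance hT).ConnectsGroup X i ↔ i ∈ (T.outcome (vertexLists X)).2 := by
  simp only [outcome, Set.mem_iUnion, mem_vertexLists]
  constructor
  · rintro ⟨t, ht, p, hp⟩
    exact ⟨t.1, ⟨t.2, SimpleGraph.Subgraph.verts_mono hp
      (p.mem_verts_toSubgraph.2 p.end_mem_support)⟩, ht⟩
  · rintro ⟨l, ⟨hl, hlX⟩, hi⟩
    obtain ⟨p, hp⟩ := ((SimpleGraph.Subgraph.connected_iff_forall_exists_walk_subgraph X).1
      hX.connected).2 hX.root_mem hlX
    exact ⟨⟨l, hl⟩, hi, p, hp⟩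

end Instance

/-- The valid subtrees of the instance given by `T` achieve exactly the outcomes in `T.Out`. -/
theorem exists_treeInstance (T : RTree h) (hT : T.WF true) (h0 : T.cost = 0) :
    ∃ I : TreeInstance h, Nat.card I.Node ≤ T.size ∧
      (∀ o ∈ T.Out true, ∃ X, I.IsValid X ∧ I.subtreeCost X = o.1 ∧
        ∀ i, I.ConnectsGroup X i ↔ i ∈ o.2) ∧
      ∀ X, I.IsValid X → ∃ o ∈ T.Out true, I.subtreeCost X = o.1 ∧
        ∀ i, I.ConnectsGroup X i ↔ i ∈ o.2 := by
  refine ⟨T.toInstance hT, card_toInstance, fun o ho => ?_, fun X hX => ?_⟩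
  · obtain ⟨W, hW, rfl⟩ := mem_Out_iff.1 ho
    obtain ⟨X, hX, rfl⟩ := isValid_of_isSolution (hT := hT) hW
    exact ⟨X, hX, subtreeCost_eq h0 hX, connectsGroup_iff hX⟩
  · exact ⟨_, mem_Out_iff.2 ⟨_, isSolution_vertexLists hX, rfl⟩, subtreeCost_eq h0 hX,
      connectsGroup_iff hX⟩

end RTree

/-! ### Balanced separations from tree decompositions. -/

section Separation

open SimpleGraph

section Tree

variable {N : Type*} {T : SimpleGraph N}

theorem SimpleGraph.Connected.exists_adj_dist_eq (hT : T.Connected) {x t : N} (hne : x ≠ t) :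
    ∃ z, T.Adj x z ∧ T.dist x t = T.dist z t + 1 := by
  obtain ⟨p, hp⟩ := hT.exists_walk_length_eq_dist x t
  cases p with
  | nil => exact absurd rfl hne
  | @cons _ z _ hxz p =>
    refine ⟨z, hxz, le_antisymm ?_ ?_⟩
    · have h1 := hT.dist_triangle (u := x) (v := z) (w := t)
      rw [dist_eq_one_iff_adj.2 hxz] at h1
      omega
    · rw [← hp, Walk.length_cons]
      exact Nat.add_le_add_right (dist_le p) 1

theorem SimpleGraph.IsTree.parent_unique (hT : T.IsTree) {ρ x y z : N} (hy : T.Adj y x)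
    (hz : T.Adj z x) (hyd : T.dist ρ x = T.dist ρ y + 1) (hzd : T.dist ρ x = T.dist ρ z + 1) :
    y = z := by
  obtain ⟨p, hp⟩ := hT.connected.exists_walk_length_eq_dist ρ y
  obtain ⟨q, hq⟩ := hT.connected.exists_walk_length_eq_dist ρ z
  have hp' : (p.concat hy).IsPath :=
    Walk.isPath_of_length_eq_dist _ (by rw [Walk.length_concat, hp, hyd])
  have hq' : (q.concat hz).IsPath :=
    Walk.isPath_of_length_eq_dist _ (by rw [Walk.length_concat, hq, hzd])
  have := congrArg (fun w : T.Path ρ x => w.1.penultimate)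
    ((hT.isAcyclic.subsingleton_path ρ x).elim ⟨_, hp'⟩ ⟨_, hq'⟩)
  simpa using this

/-- The nodes below `t` if the tree is rooted at `ρ`. -/
def treeBelow (T : SimpleGraph N) (ρ t : N) : Set N :=
  {x | T.dist ρ x = T.dist ρ t + T.dist t x}

/-- A neighbour of `x` is a child of `x` or its parent; since `x ≠ t`, the parent is the neighbour
of `x` on the way to `t`. -/
theorem mem_treeBelow_of_adj (hT : T.IsTree) {ρ t x y : N} (hx : x ∈ treeBelow T ρ t)
    (hne : x ≠ t) (hxy : T.Adj x y) : y ∈ treeBelow T ρ t := by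
  have hc := hT.connected
  have hx' : T.dist ρ x = T.dist ρ t + T.dist t x := hx
  have h1 := hc.dist_triangle (u := ρ) (v := t) (w := y)
  rcases hT.dist_eq_dist_add_one_of_adj ρ hxy with h2 | h2
  · obtain ⟨z, hxz, hz⟩ := hc.exists_adj_dist_eq hne
    rw [dist_comm, dist_comm (u := z)] at hz
    have h3 := hc.dist_triangle (u := ρ) (v := t) (w := z)
    have h4 : T.dist ρ x = T.dist ρ z + 1 := by
      rcases hT.dist_eq_dist_add_one_of_adj ρ hxz with h | h <;> omega
    rw [hT.parent_unique hxy.symm hxz.symm h2 h4]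
    change T.dist ρ z = _
    omega
  · have h3 := hc.dist_triangle (u := t) (v := x) (w := y)
    rw [dist_eq_one_iff_adj.2 hxy] at h3
    change T.dist ρ y = _
    omega

theorem exists_child_below (hT : T.IsTree) {ρ t x : N} (hx : x ∈ treeBelow T ρ t) (hne : x ≠ t) :
    ∃ c, T.Adj t c ∧ T.dist ρ c = T.dist ρ t + 1 ∧ x ∈ treeBelow T ρ c := by
  have hc := hT.connected
  have hx' : T.dist ρ x = T.dist ρ t + T.dist t x := hx
  obtain ⟨c, htc, h1⟩ := hc.exists_adj_dist_eq hne.symm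
  have h2 := hc.dist_triangle (u := ρ) (v := c) (w := x)
  have h3 : T.dist ρ c = T.dist ρ t + 1 := by
    rcases hT.dist_eq_dist_add_one_of_adj ρ htc with h | h <;> omega
  refine ⟨c, htc, h3, ?_⟩
  change T.dist ρ x = _
  omega

theorem eq_of_adj_of_mem_below (hT : T.IsTree) {ρ t c x y : N} (htc : T.Adj t c)
    (hd : T.dist ρ c = T.dist ρ t + 1) (hx : x ∈ treeBelow T ρ c) (hy : y ∉ treeBelow T ρ c)
    (hxy : T.Adj x y) : y = t := by
  have hxc : x = c := by
    by_contra hne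
    exact hy (mem_treeBelow_of_adj hT hx hne hxy)
  subst hxc
  rcases hT.dist_eq_dist_add_one_of_adj ρ hxy with h | h
  · exact hT.parent_unique hxy.symm htc h hd
  · refine absurd ?_ hy
    change T.dist ρ y = _
    rw [dist_eq_one_iff_adj.2 hxy, h]

end Tree

variable {V : Type*} {G : SimpleGraph V}

/-- The nodes whose bags contain `v` are connected and do not include `t`, the only way out of `K`.
-/
theorem TreeDecomposition.mem_of_mem_bag (D : TreeDecomposition G) {K : Set D.Node} {t : D.Node}
    (hK : ∀ x ∈ K, ∀ y ∉ K, D.tree.Adj x y → y = t) {v : V} (hv : v ∉ D.bag t) {x y : D.Node}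
    (hx : x ∈ K) (hvx : v ∈ D.bag x) (hvy : v ∈ D.bag y) : y ∈ K := by
  by_contra hy
  obtain ⟨p⟩ := D.bag_connected v ⟨x, hvx⟩ ⟨y, hvy⟩
  obtain ⟨d, -, h1, h2⟩ := p.exists_boundary_dart {a | a.1 ∈ K} hx hy
  have h3 := hK _ h1 _ h2 d.adj
  exact hv (h3 ▸ d.snd.2)

/-- The graph obtained from `G` by isolating the vertices in `S`. -/
def isolate (G : SimpleGraph V) (S : Finset V) : SimpleGraph V where
  Adj u v := G.Adj u v ∧ u ∉ S ∧ v ∉ S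
  symm := ⟨fun _ _ h => ⟨h.1.symm, h.2.2, h.2.1⟩⟩
  loopless := ⟨fun _ h => h.1.ne rfl⟩

theorem TreeDecomposition.mem_of_reachable (D : TreeDecomposition G) {K : Set D.Node}
    {t : D.Node} (hK : ∀ x ∈ K, ∀ y ∉ K, D.tree.Adj x y → y = t) {u v : V}
    (huv : (isolate G (D.bag t)).Reachable u v) (hu : u ∉ D.bag t)
    (huK : ∃ x ∈ K, u ∈ D.bag x) : ∃ x ∈ K, v ∈ D.bag x := by
  obtain ⟨p⟩ := huv
  induction p with
  | nil => exact huK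
  | cons hab p ih =>
    refine ih hab.2.2 ?_
    obtain ⟨x, hx, hux⟩ := huK
    obtain ⟨y, hy1, hy2⟩ := D.edge_mem _ _ hab.1
    exact ⟨y, D.mem_of_mem_bag hK hu hx hux hy1, hy2⟩

open Classical in
/-- Some bag splits the graph in components with at most half of the vertices of `W` each. -/
theorem TreeDecomposition.exists_half_separator (D : TreeDecomposition G) (W : Finset V) :
    ∃ t, ∀ q : (isolate G (D.bag t)).ConnectedComponent,
      2 * (W.filter fun v => v ∉ D.bag t ∧
        (isolate G (D.bag t)).connectedComponentMk v = q).card ≤ W.card := by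
  obtain ⟨ρ⟩ := D.isTree.connected.nonempty
  have := D.finite
  have := Fintype.ofFinite D.Node
  rcases W.eq_empty_or_nonempty with rfl | hW
  · exact ⟨ρ, fun q => by simp⟩
  let cov : D.Node → Finset V := fun t =>
    W.filter fun v => ∃ x ∈ treeBelow D.tree ρ t, v ∈ D.bag x
  let H : Finset D.Node := Finset.univ.filter fun t => W.card < 2 * (cov t).card
  have hρ : ρ ∈ H := by
    have : cov ρ = W := by
      refine Finset.filter_true_of_mem fun v _ => ?_
      obtain ⟨x, hx⟩ := D.vertex_mem v
      exact ⟨x, by simp [treeBelow], hx⟩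
    have h2 := hW.card_pos
    simp only [H, Finset.mem_filter, Finset.mem_univ, true_and, this]
    omega
  -- Take the deepest node below which the bags cover more than half of `W`. A component with more
  -- than half of `W` would meet this covered part, hence lie entirely below one child of `t`, which
  -- contradicts depth.
  obtain ⟨t, ht, hmax⟩ := H.exists_max_image (fun t => D.tree.dist ρ t) ⟨ρ, hρ⟩
  refine ⟨t, fun q => ?_⟩
  by_contra! hq
  set Q := W.filter fun v => v ∉ D.bag t ∧
        (isolate G (D.bag t)).connectedComponentMk v = q with hQ
  have ht' : W.card < 2 * (cov t).card := (Finset.mem_filter.1 ht).2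
  obtain ⟨v, hv⟩ : (Q ∩ cov t).Nonempty := by
    rw [← Finset.card_pos]
    have h1 := Finset.card_union_add_card_inter Q (cov t)
    have h2 : (Q ∪ cov t).card ≤ W.card := Finset.card_le_card
      (Finset.union_subset (Finset.filter_subset _ _) (Finset.filter_subset _ _))
    omega
  obtain ⟨hvQ, hvc⟩ := Finset.mem_inter.1 hv
  obtain ⟨-, hvt, hvq⟩ := Finset.mem_filter.1 hvQ
  obtain ⟨-, x, hx, hvx⟩ := Finset.mem_filter.1 hvc
  obtain ⟨c, htc, hd, hxc⟩ := exists_child_below D.isTree hx (fun h => hvt (h ▸ hvx))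
  have hsub : Q ⊆ cov c := by
    intro u hu
    obtain ⟨huW, -, huq⟩ := Finset.mem_filter.1 hu
    refine Finset.mem_filter.2 ⟨huW, ?_⟩
    exact D.mem_of_reachable
      (fun a ha b hb hab => eq_of_adj_of_mem_below D.isTree htc hd ha hb hab)
      (ConnectedComponent.exact (hvq.trans huq.symm)) hvt ⟨x, hxc, hvx⟩
  have hcH : c ∈ H := Finset.mem_filter.2 ⟨Finset.mem_univ _, by
    have := Finset.card_le_card hsub
    omega⟩
  have := hmax c hcH
  omega

/-- Take a subset of largest sum up to `2n/3`. If its complement is too heavy, the subset weighs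
less than `n/3`, so any further `j` with `f j ≠ 0` must weigh more than `n/3` by maximality; since
it weighs at most `n/2`, `{j}` alone is balanced. -/
theorem exists_balanced_subset {ι : Type*} [DecidableEq ι] (s : Finset ι) (f : ι → ℕ) (n : ℕ)
    (hf : ∀ i ∈ s, 2 * f i ≤ n) (hs : ∑ i ∈ s, f i ≤ n) :
    ∃ I ⊆ s, 3 * ∑ i ∈ I, f i ≤ 2 * n ∧ 3 * ∑ i ∈ s \ I, f i ≤ 2 * n := by
  obtain ⟨I, hI, hmax⟩ := (s.powerset.filter fun I => 3 * ∑ i ∈ I, f i ≤ 2 * n).exists_max_image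
    (fun I => ∑ i ∈ I, f i) ⟨∅, by simp⟩
  obtain ⟨hIs, hIn⟩ := Finset.mem_filter.1 hI
  rw [Finset.mem_powerset] at hIs
  by_cases hc : 3 * ∑ i ∈ s \ I, f i ≤ 2 * n
  · exact ⟨I, hIs, hIn, hc⟩
  have hsum := Finset.sum_sdiff hIs (f := f)
  obtain ⟨j, hj, hj0⟩ := Finset.exists_ne_zero_of_sum_ne_zero
    (show ∑ i ∈ s \ I, f i ≠ 0 by omega)
  obtain ⟨hjs, hjI⟩ := Finset.mem_sdiff.1 hj
  have h2 := hf j hjs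
  have h1 : n < 3 * f j := by
    by_contra h3
    have hsum' := Finset.sum_insert hjI (f := f)
    have := hmax (insert j I) (Finset.mem_filter.2
      ⟨Finset.mem_powerset.2 (Finset.insert_subset hjs hIs), by omega⟩)
    omega
  refine ⟨{j}, Finset.singleton_subset_iff.2 hjs, ?_, ?_⟩
  · rw [Finset.sum_singleton]; omega
  · have := Finset.sum_sdiff (Finset.singleton_subset_iff.2 hjs) (f := f)
    rw [Finset.sum_singleton] at this
    omega

/-- `A` is a union of components left after removing the bag of a half separator, grouped by
`exists_balanced_subset`. -/
theorem TreeDecomposition.exists_balanced_separation [Fintype V] [DecidableEq V]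
    (D : TreeDecomposition G)
    (W : Finset V) :
    ∃ (t : D.Node) (A : Finset V), Disjoint A (D.bag t) ∧
      (∀ a ∈ A, ∀ c, G.Adj a c → c ∈ A ∪ D.bag t) ∧
      3 * (W ∩ A).card ≤ 2 * W.card ∧ 3 * (W \ (A ∪ D.bag t)).card ≤ 2 * W.card := by
  classical
  obtain ⟨t, ht⟩ := D.exists_half_separator W
  let comp := (isolate G (D.bag t)).connectedComponentMk
  let f : (isolate G (D.bag t)).ConnectedComponent → ℕ := fun q =>
    (W.filter fun v => v ∉ D.bag t ∧ comp v = q).card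
  have hfib : ∀ I : Finset (isolate G (D.bag t)).ConnectedComponent,
      ∑ q ∈ I, f q = (W.filter fun v => v ∉ D.bag t ∧ comp v ∈ I).card := by
    intro I
    rw [Finset.card_eq_sum_card_fiberwise (f := comp) (t := I)
      (fun v hv => (Finset.mem_filter.1 hv).2.2)]
    refine Finset.sum_congr rfl fun q hq => ?_
    refine congrArg Finset.card (Finset.ext fun v => ?_)
    simp only [Finset.mem_filter]
    constructor
    · rintro ⟨h1, h2, rfl⟩
      exact ⟨⟨h1, h2, hq⟩, rfl⟩
    · rintro ⟨⟨h1, h2, -⟩, rfl⟩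
      exact ⟨h1, h2, rfl⟩
  obtain ⟨I, -, hI1, hI2⟩ := exists_balanced_subset Finset.univ f W.card (fun q _ => by convert ht q)
    (by rw [hfib]; exact Finset.card_filter_le _ _)
  rw [hfib] at hI1 hI2
  refine ⟨t, Finset.univ.filter fun v => v ∉ D.bag t ∧ comp v ∈ I, ?_, ?_, ?_, ?_⟩
  · rw [Finset.disjoint_left]
    exact fun v hv => (Finset.mem_filter.1 hv).2.1
  · intro a ha c hac
    obtain ⟨-, h1, h2⟩ := Finset.mem_filter.1 ha
    rw [Finset.mem_union]
    by_cases hc : c ∈ D.bag t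
    · exact Or.inr hc
    · refine Or.inl (Finset.mem_filter.2 ⟨Finset.mem_univ _, hc, ?_⟩)
      have : comp a = comp c := ConnectedComponent.sound
        (Adj.reachable (show (isolate G (D.bag t)).Adj a c from ⟨hac, h1, hc⟩))
      rwa [← this]
  · refine le_trans (Nat.mul_le_mul_left 3 (Finset.card_le_card fun v hv => ?_)) hI1
    simpa using hv
  · refine le_trans (Nat.mul_le_mul_left 3 (Finset.card_le_card fun v hv => ?_)) hI2
    simp only [Finset.mem_sdiff, Finset.mem_union, Finset.mem_filter, Finset.mem_univ,
      true_and, not_or] at hv ⊢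
    exact ⟨hv.1, hv.2.2, fun h => hv.2.1 ⟨hv.2.2, h⟩⟩

/-- The one-bag decomposition shows that the infimum defining `treewidth` is over a nonempty set,
hence attained. -/
theorem exists_treeDecomposition [Fintype V] (G : SimpleGraph V) {w : ℕ} (hw : treewidth G ≤ w) :
    ∃ D : TreeDecomposition G, ∀ t, (D.bag t).card ≤ w + 1 := by
  let D : TreeDecomposition G :=
    { Node := Unit
      finite := inferInstance
      tree := ⊥
      isTree := IsTree.of_subsingleton
      bag := fun _ => Finset.univ
      vertex_mem := fun v => ⟨(), Finset.mem_univ v⟩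
      edge_mem := fun u v _ => ⟨(), Finset.mem_univ u, Finset.mem_univ v⟩
      bag_connected := fun v a b => by rw [Subsingleton.elim a b] }
  have hne : {m : ℕ | ∃ D : TreeDecomposition G, ∀ t, (D.bag t).card ≤ m + 1}.Nonempty :=
    ⟨Fintype.card V, D, fun t => Nat.le_succ _⟩
  obtain ⟨D', hD'⟩ := Nat.sInf_mem hne
  exact ⟨D', fun t => (hD' t).trans (Nat.add_le_add_right hw 1)⟩

end Separation

/-! ### Building blocks: leaves, pairs and choices. -/

namespace RTree

variable {h : ℕ}

/-- The node without children with the given labels and cost. -/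
def leaf (l : Set (Fin h)) (c : ℝ≥0) : RTree h := mk l c 0 fun _ => nil

theorem leaf_WF (l : Set (Fin h)) (c : ℝ≥0) : (leaf l c).WF true := by
  simp [leaf, WF]

theorem leaf_size (l : Set (Fin h)) (c : ℝ≥0) : (leaf l c).size = 1 := by
  simp [leaf, size]

theorem leaf_Out (l : Set (Fin h)) (c : ℝ≥0) : (leaf l c).Out true = {(c, l)} := by
  ext o
  simp only [leaf, Out, Finset.range_zero, Finset.subset_empty, Set.mem_ofPred_eq,
    Set.mem_singleton_iff]
  constructor
  · rintro ⟨J, g, rfl, -, -, rfl⟩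
    simp
  · rintro rfl
    exact ⟨∅, fun _ => (0, ∅), rfl, by simp [Step], by simp, by simp⟩

/-- A connecting node with two children. -/
def pair (A B : RTree h) : RTree h := mk ∅ 0 2 fun j => if j = 0 then A else B

theorem pair_Out (A B : RTree h) : (pair A B).Out false =
    {o | ∃ a ∈ A.Out true, ∃ b ∈ B.Out true, o = (a.1 + b.1, a.2 ∪ b.2)} := by
  ext o
  simp only [pair, Out, Set.mem_ofPred_eq]
  constructor
  · rintro ⟨J, g, hJ, hS, hg, rfl⟩
    have : J = Finset.range 2 := Finset.Subset.antisymm hJ fun x hx => by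
      simpa using hS x (Finset.mem_range.1 hx)
    subst this
    refine ⟨g 0, by simpa using hg 0 (by simp), g 1, by simpa using hg 1 (by simp), ?_⟩
    refine Prod.ext ?_ ?_
    · simp [Finset.sum_range_succ]
    · ext i; simp [Nat.le_one_iff_eq_zero_or_eq_one]
  · rintro ⟨a, ha, b, hb, rfl⟩
    refine ⟨Finset.range 2, fun j => if j = 0 then a else b, subset_rfl, by simp [Step],
      fun j hj => ?_, ?_⟩
    · by_cases h0 : j = 0 <;> simp [h0, ha, hb]
    · refine Prod.ext ?_ ?_
      · simp [Finset.sum_range_succ]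
      · ext i
        simp [Nat.le_one_iff_eq_zero_or_eq_one]

/-- A tree that offers, for every `a ∈ P`, the combinations of solutions of `A a` and `B a`. -/
theorem exists_choice {α : Type*} (P : Finset α) (hP : P.Nonempty) (A B : α → RTree h)
    (l : Set (Fin h)) (N : ℕ) (hA : ∀ a ∈ P, (A a).WF true ∧ (A a).size ≤ N)
    (hB : ∀ a ∈ P, (B a).WF true ∧ (B a).size ≤ N) :
    ∃ T : RTree h, T.WF true ∧ T.cost = 0 ∧ T.size ≤ 1 + P.card * (1 + 2 * N) ∧
      T.Out true = {o | ∃ a ∈ P, ∃ x ∈ (A a).Out true, ∃ y ∈ (B a).Out true,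
        o = (x.1 + y.1, l ∪ (x.2 ∪ y.2))} := by
  let e := P.equivFin
  let g : ℕ → RTree h := fun i =>
    if hi : i < P.card then pair (A (e.symm ⟨i, hi⟩)) (B (e.symm ⟨i, hi⟩)) else nil
  have hg : ∀ i (hi : i < P.card),
      g i = pair (A (e.symm ⟨i, hi⟩)) (B (e.symm ⟨i, hi⟩)) := fun i hi => dif_pos hi
  refine ⟨mk l 0 P.card g, ⟨fun hf => by simp at hf, fun i hi => ?_⟩, rfl, ?_, ?_⟩
  · rw [hg i hi]
    refine ⟨fun _ => ⟨by norm_num, rfl⟩, fun j _ => ?_⟩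
    by_cases h0 : j = 0
    · simpa [h0] using (hA _ (e.symm ⟨i, hi⟩).2).1
    · simpa [h0] using (hB _ (e.symm ⟨i, hi⟩).2).1
  · rw [size]
    refine Nat.add_le_add_left ?_ 1
    calc ∑ i ∈ Finset.range P.card, (g i).size
        ≤ ∑ i ∈ Finset.range P.card, (1 + 2 * N) := Finset.sum_le_sum fun i hi => by
          rw [hg i (Finset.mem_range.1 hi), pair, size]
          have h1 := (hA _ (e.symm ⟨i, Finset.mem_range.1 hi⟩).2).2
          have h2 := (hB _ (e.symm ⟨i, Finset.mem_range.1 hi⟩).2).2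
          simp only [Finset.sum_range_succ, Finset.range_zero, Finset.sum_empty, if_true,
            one_ne_zero, if_false]
          omega
      _ = _ := by simp
  · ext o
    simp only [Out, Set.mem_ofPred_eq]
    constructor
    · rintro ⟨J, f, hJ, hS, hf, rfl⟩
      -- The root is ordinary and has children because `P` is nonempty, so exactly one child is
      -- chosen.
      obtain ⟨i, hi, hi'⟩ := hS hP.card_pos
      have hJi : J = {i} := Finset.eq_singleton_iff_unique_mem.2
        ⟨by simpa using hi, fun x hx => hi' x (by simpa using hx)⟩
      subst hJi
      have hiP : i < P.card := by simpa using hJ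
      have hfi := hf i (by simp)
      rw [hg i hiP] at hfi
      have := Set.ext_iff.1 (pair_Out (A (e.symm ⟨i, hiP⟩)) (B (e.symm ⟨i, hiP⟩))) (f i)
      obtain ⟨x, hx, y, hy, hxy⟩ := this.1 hfi
      exact ⟨e.symm ⟨i, hiP⟩, (e.symm ⟨i, hiP⟩).2, x, hx, y, hy, by simp [hxy]⟩
    · rintro ⟨a, ha, x, hx, y, hy, rfl⟩
      have hiP : (e ⟨a, ha⟩ : ℕ) < P.card := (e ⟨a, ha⟩).2
      refine ⟨{(e ⟨a, ha⟩ : ℕ)}, fun _ => (x.1 + y.1, x.2 ∪ y.2), by simp,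
        fun _ => ⟨(e ⟨a, ha⟩ : ℕ), by simp, by simp⟩, fun j hj => ?_, by simp⟩
      rw [Finset.mem_singleton.1 hj, hg _ hiP]
      have h1 : ((e.symm ⟨(e ⟨a, ha⟩ : ℕ), hiP⟩ : P) : α) = a := by simp
      rw [h1]
      have := Set.ext_iff.1 (pair_Out (A a) (B a)) (x.1 + y.1, x.2 ∪ y.2)
      exact this.2 ⟨x, hx, y, hy, rfl⟩

end RTree

/-! ### Cut profiles on a boundary. -/

section Profile

variable {V : Type*}

/-- The vertex `v` is an end of an edge of `F`. -/
def Touches (F : Finset (Sym2 V)) (v : V) : Prop := ∃ e ∈ F, v ∈ e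

theorem Touches.mono {F F' : Finset (Sym2 V)} (hF : F ⊆ F') {v : V} (hv : Touches F v) :
    Touches F' v := by
  obtain ⟨e, he, hve⟩ := hv
  exact ⟨e, hF he, hve⟩

theorem cutEdges_congr {F : Finset (Sym2 V)} {X Y : Finset V}
    (hXY : ∀ v, Touches F v → (v ∈ X ↔ v ∈ Y)) : cutEdges F X = cutEdges F Y := by
  ext e
  rw [mem_cutEdges, mem_cutEdges]
  refine and_congr_right fun he => ?_
  constructor
  · rintro ⟨x, hx, y, hy, rfl⟩
    exact ⟨x, (hXY x ⟨_, he, Sym2.mem_mk_left x y⟩).1 hx, y,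
      fun h => hy ((hXY y ⟨_, he, Sym2.mem_mk_right x y⟩).2 h), rfl⟩
  · rintro ⟨x, hx, y, hy, rfl⟩
    exact ⟨x, (hXY x ⟨_, he, Sym2.mem_mk_left x y⟩).2 hx, y,
      fun h => hy ((hXY y ⟨_, he, Sym2.mem_mk_right x y⟩).1 h), rfl⟩

variable [DecidableEq V]

theorem touches_union {F F' : Finset (Sym2 V)} {v : V} :
    Touches (F ∪ F') v ↔ Touches F v ∨ Touches F' v := by
  simp [Touches, or_and_right, exists_or]

theorem cutEdges_union (F F' : Finset (Sym2 V)) (X : Finset V) :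
    cutEdges (F ∪ F') X = cutEdges F X ∪ cutEdges F' X := by
  ext e
  simp only [mem_cutEdges, Finset.mem_union, or_and_right]

theorem card_cutEdges_union {F F' : Finset (Sym2 V)} (hd : Disjoint F F') (X : Finset V) :
    (cutEdges (F ∪ F') X).card = (cutEdges F X).card + (cutEdges F' X).card := by
  rw [cutEdges_union, Finset.card_union_of_disjoint]
  exact Finset.disjoint_of_subset_left (fun e he => (mem_cutEdges.1 he).1)
    (Finset.disjoint_of_subset_right (fun e he => (mem_cutEdges.1 he).1) hd)

open Classical in
/-- The pairs `(Z, j)` such that `F` has a cut with trace `Z` on `B` and at most `j < k` edges. -/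
noncomputable def profile (k : ℕ) (B : Finset V) (F : Finset (Sym2 V)) : Finset (Finset V × ℕ) :=
  (B.powerset ×ˢ Finset.range k).filter fun q =>
    ∃ X : Finset V, X ∩ B = q.1 ∧ (cutEdges F X).card ≤ q.2

theorem mem_profile {k : ℕ} {B : Finset V} {F : Finset (Sym2 V)} {Z : Finset V} {j : ℕ} :
    (Z, j) ∈ profile k B F ↔
      j < k ∧ ∃ X : Finset V, X ∩ B = Z ∧ (cutEdges F X).card ≤ j := by
  classical
  rw [profile, Finset.mem_filter, Finset.mem_product, Finset.mem_powerset, Finset.mem_range]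
  constructor
  · rintro ⟨⟨-, hj⟩, hX⟩
    exact ⟨hj, hX⟩
  · rintro ⟨hj, X, rfl, hX⟩
    exact ⟨⟨Finset.inter_subset_right, hj⟩, X, rfl, hX⟩

theorem profile_mem_powerset (k : ℕ) (B : Finset V) (F : Finset (Sym2 V)) :
    profile k B F ∈ (B.powerset ×ˢ Finset.range k).powerset := by
  classical
  rw [Finset.mem_powerset, profile]
  exact Finset.filter_subset _ _

theorem exists_cut_of_profile_eq {k : ℕ} {B : Finset V} {F F' : Finset (Sym2 V)}
    (h : profile k B F = profile k B F') {X : Finset V} {j : ℕ} (hj : j < k)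
    (hX : (cutEdges F X).card ≤ j) :
    ∃ Y : Finset V, Y ∩ B = X ∩ B ∧ (cutEdges F' Y).card ≤ j := by
  have h1 : (X ∩ B, j) ∈ profile k B F := mem_profile.2 ⟨hj, X, rfl, hX⟩
  rw [h] at h1
  exact (mem_profile.1 h1).2

/-- The groups that are satisfied in `F` at an end of an edge in `E`. -/
def satisfied {h : ℕ} (r : V) (S : Fin h → Set V) (d : Fin h → ℕ) (E F : Finset (Sym2 V)) :
    Set (Fin h) :=
  {i | ∃ v ∈ S i, Touches E v ∧ EdgeConnects F (d i) r v}

theorem satisfied_union_left {h : ℕ} (r : V) (S : Fin h → Set V) (d : Fin h → ℕ)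
    (E₁ E₂ F : Finset (Sym2 V)) :
    satisfied r S d (E₁ ∪ E₂) F = satisfied r S d E₁ F ∪ satisfied r S d E₂ F := by
  ext i
  simp only [satisfied, touches_union, Set.mem_ofPred_eq, Set.mem_union]
  constructor
  · rintro ⟨v, h1, h2 | h2, h3⟩
    · exact Or.inl ⟨v, h1, h2, h3⟩
    · exact Or.inr ⟨v, h1, h2, h3⟩
  · rintro (⟨v, h1, h2, h3⟩ | ⟨v, h1, h2, h3⟩)
    · exact ⟨v, h1, Or.inl h2, h3⟩
    · exact ⟨v, h1, Or.inr h2, h3⟩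

variable [Fintype V]

/-- Exchange the `F₁`-part of a small cut `X` for a cut `Y` of `F₁'` with the same trace on `B` and
no more edges. The glued set follows `Y` at vertices touched by `E₁` and `X` elsewhere; the two
agree on `B`, so `F₂` and the trace on `M` see only `X`. -/
theorem profile_union_subset {k : ℕ} {B M : Finset V} {E₁ E₂ F₁ F₁' F₂ : Finset (Sym2 V)}
    (hd : Disjoint E₁ E₂) (hB : ∀ v, Touches E₁ v → Touches E₂ v → v ∈ B)
    (hM : ∀ v ∈ M, Touches E₁ v → v ∈ B) (h₁ : F₁ ⊆ E₁) (h₁' : F₁' ⊆ E₁) (h₂ : F₂ ⊆ E₂)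
    (h : profile k B F₁ = profile k B F₁') :
    profile k M (F₁ ∪ F₂) ⊆ profile k M (F₁' ∪ F₂) := by
  classical
  rintro ⟨Z, j⟩ hZ
  obtain ⟨hj, X, rfl, hX⟩ := mem_profile.1 hZ
  rw [card_cutEdges_union (Finset.disjoint_of_subset_left h₁
    (Finset.disjoint_of_subset_right h₂ hd))] at hX
  obtain ⟨Y, hYB, hY⟩ := exists_cut_of_profile_eq h
    (show (cutEdges F₁ X).card < k by omega) le_rfl
  have hXY : ∀ v ∈ B, v ∈ Y ↔ v ∈ X := fun v hv => by
    have := Finset.ext_iff.1 hYB v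
    simpa [hv] using this
  let U : Finset V := Finset.univ.filter fun v => if Touches E₁ v then v ∈ Y else v ∈ X
  have hU₁ : ∀ v, Touches E₁ v → (v ∈ U ↔ v ∈ Y) := fun v hv => by simp [U, hv]
  have hU₂ : ∀ v, (Touches E₁ v → v ∈ B) → (v ∈ U ↔ v ∈ X) := fun v hv => by
    by_cases ht : Touches E₁ v
    · rw [hU₁ v ht, hXY v (hv ht)]
    · simp [U, ht]
  refine mem_profile.2 ⟨hj, U, ?_, ?_⟩
  · ext v
    simp only [Finset.mem_inter]
    exact and_congr_left fun hv => hU₂ v (hM v hv)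
  · rw [card_cutEdges_union (Finset.disjoint_of_subset_left h₁'
      (Finset.disjoint_of_subset_right h₂ hd)),
      cutEdges_congr (F := F₁') fun v hv => hU₁ v (hv.mono h₁'),
      cutEdges_congr (F := F₂) fun v hv => hU₂ v fun hv' => hB v hv' (hv.mono h₂)]
    omega

/-- Profiles are compatible with unions of edge sets that meet in the boundary. -/
theorem profile_union_congr {k : ℕ} {B M : Finset V} {E₁ E₂ F₁ F₁' F₂ : Finset (Sym2 V)}
    (hd : Disjoint E₁ E₂) (hB : ∀ v, Touches E₁ v → Touches E₂ v → v ∈ B)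
    (hM : ∀ v ∈ M, Touches E₁ v → v ∈ B) (h₁ : F₁ ⊆ E₁) (h₁' : F₁' ⊆ E₁) (h₂ : F₂ ⊆ E₂)
    (h : profile k B F₁ = profile k B F₁') :
    profile k M (F₁ ∪ F₂) = profile k M (F₁' ∪ F₂) :=
  (profile_union_subset hd hB hM h₁ h₁' h₂ h).antisymm
    (profile_union_subset hd hB hM h₁' h₁ h₂ h.symm)

/-- By Menger, failure means a cut with fewer than `m ≤ k` edges between `r` and `v`. The profile
records such cuts together with the sides of `r` and `v`. -/
theorem EdgeConnects.of_profile_eq {k m : ℕ} {B : Finset V} {F F' : Finset (Sym2 V)} {r v : V}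
    (h : profile k B F = profile k B F') (hm : m ≤ k) (hr : r ∈ B) (hv : v ∈ B)
    (hF : EdgeConnects F m r v) : EdgeConnects F' m r v := by
  rcases eq_or_ne r v with rfl | hrv
  · exact edgeConnects_self F' m r
  rw [edgeConnects_iff_cut hrv] at hF ⊢
  intro X hrX hvX
  by_contra! hlt
  obtain ⟨Y, hYB, hY⟩ := exists_cut_of_profile_eq h.symm
    (show (cutEdges F' X).card < k by omega) le_rfl
  have hXY : ∀ v ∈ B, v ∈ Y ↔ v ∈ X := fun v hv => by
    have := Finset.ext_iff.1 hYB v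
    simpa [hv] using this
  have := hF Y ((hXY r hr).2 hrX) fun h => hvX ((hXY v hv).1 h)
  omega

/-- For a vertex `v` touched by `E₁`, equality of profiles on `B` carries over to profiles of the
unions on `{r, v}`, since `v` lies in `B` as soon as `E₂` touches it. -/
theorem satisfied_congr {h k : ℕ} {r : V} {S : Fin h → Set V} {d : Fin h → ℕ}
    (hd : ∀ i, d i ≤ k) {B : Finset V} (hr : r ∈ B) {E₁ E₂ F₁ F₂ F₂' : Finset (Sym2 V)}
    (hdis : Disjoint E₁ E₂) (hB : ∀ v, Touches E₁ v → Touches E₂ v → v ∈ B)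
    (h₁ : F₁ ⊆ E₁) (h₂ : F₂ ⊆ E₂) (h₂' : F₂' ⊆ E₂)
    (hp : profile k B F₂ = profile k B F₂') :
    satisfied r S d E₁ (F₁ ∪ F₂) = satisfied r S d E₁ (F₁ ∪ F₂') := by
  have key : ∀ F₂ F₂' : Finset (Sym2 V), F₂ ⊆ E₂ → F₂' ⊆ E₂ →
      profile k B F₂ = profile k B F₂' →
      satisfied r S d E₁ (F₁ ∪ F₂) ⊆ satisfied r S d E₁ (F₁ ∪ F₂') := by
    rintro F₂ F₂' h₂ h₂' hp i ⟨v, hvS, hv, hF⟩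
    refine ⟨v, hvS, hv, hF.of_profile_eq (k := k) (B := {r, v}) ?_ (hd i) (by simp) (by simp)⟩
    rw [Finset.union_comm F₁, Finset.union_comm F₁]
    refine profile_union_congr hdis.symm (fun v h1 h2 => hB v h2 h1) ?_ h₂ h₂' h₁ hp
    intro u hu hu2
    rcases Finset.mem_insert.1 hu with rfl | hu
    · exact hr
    · rw [Finset.mem_singleton] at hu
      subst hu
      exact hB u hv hu2
  exact (key F₂ F₂' h₂ h₂' hp).antisymm (key F₂' F₂ h₂' h₂ hp.symm)

end Profile

/-! ### Realizing the choices inside a piece by a tree. -/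

section Realizable

theorem card_profiles_le {V : Type*} {k : ℕ} {B : Finset V} {b : ℕ} (hb : B.card ≤ b) :
    (B.powerset ×ˢ Finset.range k).powerset.card ≤ 2 ^ (2 ^ b * k) := by
  rw [Finset.card_powerset, Finset.card_product, Finset.card_powerset, Finset.card_range]
  exact Nat.pow_le_pow_right two_pos
    (Nat.mul_le_mul_right _ (Nat.pow_le_pow_right two_pos hb))

variable {V : Type*} [DecidableEq V] {h : ℕ}

/-- For every profile on `B` of a subset of `E'` and all edges `F₁` chosen outside of `E'`, there is
a tree with at most `N` nodes whose solutions are the subsets of `E'` with this profile. -/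
def Realizable (E : Finset (Sym2 V)) (c : Sym2 V → ℝ≥0) (r : V) (S : Fin h → Set V)
    (d : Fin h → ℕ) (k : ℕ) (E' : Finset (Sym2 V)) (B : Finset V) (N : ℕ) : Prop :=
  ∀ F₀ ⊆ E', ∀ F₁ ⊆ E \ E', ∃ T : RTree h, T.WF true ∧ T.cost = 0 ∧ T.size ≤ N ∧
    T.Out true = {o | ∃ F ⊆ E', profile k B F = profile k B F₀ ∧
      o = (∑ e ∈ F, c e, satisfied r S d E' (F ∪ F₁))}

variable {E : Finset (Sym2 V)} {c : Sym2 V → ℝ≥0} {r : V} {S : Fin h → Set V} {d : Fin h → ℕ}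
  {k : ℕ}

theorem Realizable.mono {E' : Finset (Sym2 V)} {B : Finset V} {N N' : ℕ}
    (hR : Realizable E c r S d k E' B N) (hN : N ≤ N') : Realizable E c r S d k E' B N' :=
  fun F₀ h₀ F₁ h₁ =>
    let ⟨T, h1, h2, h3, h4⟩ := hR F₀ h₀ F₁ h₁
    ⟨T, h1, h2, h3.trans hN, h4⟩

/-- One branch for each subset with the right profile: a connecting node, a leaf with the cost and
labels, and an empty leaf as second child, which accounts for the factor `3`. -/
theorem realizable_of_enumeration (E' : Finset (Sym2 V)) (B : Finset V) :
    Realizable E c r S d k E' B (1 + 2 ^ E'.card * 3) := by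
  intro F₀ h₀ F₁ _
  obtain ⟨T, h1, h2, h3, h4⟩ := RTree.exists_choice
    (E'.powerset.filter fun F => profile k B F = profile k B F₀)
    ⟨F₀, Finset.mem_filter.2 ⟨Finset.mem_powerset.2 h₀, rfl⟩⟩
    (fun F => RTree.leaf (satisfied r S d E' (F ∪ F₁)) (∑ e ∈ F, c e))
    (fun _ => RTree.leaf ∅ 0) ∅ 1
    (fun F _ => ⟨RTree.leaf_WF _ _, (RTree.leaf_size _ _).le⟩)
    (fun F _ => ⟨RTree.leaf_WF _ _, (RTree.leaf_size _ _).le⟩)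
  refine ⟨T, h1, h2, h3.trans ?_, ?_⟩
  · refine Nat.add_le_add_left (Nat.mul_le_mul_right _ ?_) 1
    exact (Finset.card_filter_le _ _).trans (Finset.card_powerset _).le
  · rw [h4]
    ext o
    simp only [RTree.leaf_Out, Finset.mem_filter, Finset.mem_powerset, Set.mem_singleton_iff,
      Set.mem_ofPred_eq, exists_eq_left, add_zero, Set.union_empty, Set.empty_union, and_assoc]

/-- The root offers the pairs of profiles of `(F ∩ E₁, F ∩ E₂)` over all admissible `F`. For each
pair, the tree of one side is built with a representative of the other side added to `F₁`. The
labels depend on the other side only through its profile, so any two solutions combine correctly. -/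
theorem Realizable.union [Fintype V] (hd : ∀ i, d i ≤ k) {E₁ E₂ : Finset (Sym2 V)}
    {B B₁ B₂ : Finset V} {N b : ℕ} (hdis : Disjoint E₁ E₂) (hE : E₁ ∪ E₂ ⊆ E)
    (hr₁ : r ∈ B₁) (hr₂ : r ∈ B₂) (h12 : ∀ v, Touches E₁ v → Touches E₂ v → v ∈ B₁ ∧ v ∈ B₂)
    (ho₁ : ∀ v, Touches E₁ v → Touches (E \ (E₁ ∪ E₂)) v → v ∈ B₁)
    (ho₂ : ∀ v, Touches E₂ v → Touches (E \ (E₁ ∪ E₂)) v → v ∈ B₂)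
    (hB₁ : ∀ v ∈ B, Touches E₁ v → v ∈ B₁) (hB₂ : ∀ v ∈ B, Touches E₂ v → v ∈ B₂)
    (hB₁₂ : ∀ v ∈ B₁, Touches E₂ v → v ∈ B₂) (hB₂₁ : ∀ v ∈ B₂, Touches E₁ v → v ∈ B₁)
    (hb₁ : B₁.card ≤ b) (hb₂ : B₂.card ≤ b)
    (hR₁ : Realizable E c r S d k E₁ B₁ N) (hR₂ : Realizable E c r S d k E₂ B₂ N) :
    Realizable E c r S d k (E₁ ∪ E₂) B
      (1 + 2 ^ (2 ^ b * k) * 2 ^ (2 ^ b * k) * (1 + 2 * N)) := by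
  classical
  intro F₀ h₀ F₁ h₁
  let pr : Finset (Sym2 V) × Finset (Sym2 V) →
      Finset (Finset V × ℕ) × Finset (Finset V × ℕ) :=
    fun q => (profile k B₁ q.1, profile k B₂ q.2)
  let R : Finset (Finset (Sym2 V) × Finset (Sym2 V)) :=
    (E₁.powerset ×ˢ E₂.powerset).filter fun q => profile k B (q.1 ∪ q.2) = profile k B F₀
  have hRmem : ∀ q, q ∈ R ↔ (q.1 ⊆ E₁ ∧ q.2 ⊆ E₂) ∧
      profile k B (q.1 ∪ q.2) = profile k B F₀ := fun q => by
    simp only [R, Finset.mem_filter, Finset.mem_product, Finset.mem_powerset]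
  have hsplit : ∀ F ⊆ E₁ ∪ E₂, F ∩ E₁ ∪ F ∩ E₂ = F := fun F hF => by
    rw [← Finset.inter_union_distrib_left, Finset.inter_eq_left.2 hF]
  have hE₁ : E₁ ⊆ E := Finset.subset_union_left.trans hE
  have hE₂ : E₂ ⊆ E := Finset.subset_union_right.trans hE
  have hout : ∀ F ⊆ E₂, F ∪ F₁ ⊆ E \ E₁ := fun F hF => by
    refine Finset.union_subset (fun e he => Finset.mem_sdiff.2 ⟨hE₂ (hF he), fun h =>
      Finset.disjoint_left.1 hdis h (hF he)⟩) (h₁.trans ?_)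
    exact Finset.sdiff_subset_sdiff subset_rfl Finset.subset_union_left
  have hout' : ∀ F ⊆ E₁, F ∪ F₁ ⊆ E \ E₂ := fun F hF => by
    refine Finset.union_subset (fun e he => Finset.mem_sdiff.2 ⟨hE₁ (hF he), fun h =>
      Finset.disjoint_left.1 hdis (hF he) h⟩) (h₁.trans ?_)
    exact Finset.sdiff_subset_sdiff subset_rfl Finset.subset_union_right
  have hcov₁ : ∀ v, Touches (E \ E₁) v → Touches E₂ v ∨ Touches (E \ (E₁ ∪ E₂)) v := by
    rintro v ⟨e, he, hv⟩
    rw [Finset.mem_sdiff] at he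
    by_cases h2 : e ∈ E₂
    · exact Or.inl ⟨e, h2, hv⟩
    · exact Or.inr ⟨e, by simp [he.1, he.2, h2], hv⟩
  have hcov₂ : ∀ v, Touches (E \ E₂) v → Touches E₁ v ∨ Touches (E \ (E₁ ∪ E₂)) v := by
    rintro v ⟨e, he, hv⟩
    rw [Finset.mem_sdiff] at he
    by_cases h2 : e ∈ E₁
    · exact Or.inl ⟨e, h2, hv⟩
    · exact Or.inr ⟨e, by simp [he.1, he.2, h2], hv⟩
  have hdo₁ : Disjoint E₁ (E \ (E₁ ∪ E₂)) :=
    Finset.disjoint_of_subset_left Finset.subset_union_left Finset.disjoint_sdiff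
  have hdo₂ : Disjoint E₂ (E \ (E₁ ∪ E₂)) :=
    Finset.disjoint_of_subset_left Finset.subset_union_right Finset.disjoint_sdiff
  have hsat₁ : ∀ A ⊆ E₁, ∀ Q ⊆ E₂, ∀ Q' ⊆ E₂, profile k B₂ Q = profile k B₂ Q' →
      satisfied r S d E₁ (A ∪ (Q ∪ F₁)) = satisfied r S d E₁ (A ∪ (Q' ∪ F₁)) := by
    intro A hA Q hQ Q' hQ' hp
    refine satisfied_congr hd hr₁ (E₂ := E \ E₁) Finset.disjoint_sdiff (fun v h1 h2 => ?_) hA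
      (hout Q hQ) (hout Q' hQ') (profile_union_congr hdo₂ ho₂ hB₁₂ hQ hQ' h₁ hp)
    rcases hcov₁ v h2 with h2 | h2
    · exact (h12 v h1 h2).1
    · exact ho₁ v h1 h2
  have hsat₂ : ∀ A ⊆ E₂, ∀ Q ⊆ E₁, ∀ Q' ⊆ E₁, profile k B₁ Q = profile k B₁ Q' →
      satisfied r S d E₂ (A ∪ (Q ∪ F₁)) = satisfied r S d E₂ (A ∪ (Q' ∪ F₁)) := by
    intro A hA Q hQ Q' hQ' hp
    refine satisfied_congr hd hr₂ (E₂ := E \ E₂) Finset.disjoint_sdiff (fun v h1 h2 => ?_) hA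
      (hout' Q hQ) (hout' Q' hQ') (profile_union_congr hdo₁ ho₁ hB₂₁ hQ hQ' h₁ hp)
    rcases hcov₂ v h2 with h2 | h2
    · exact (h12 v h2 h1).2
    · exact ho₂ v h1 h2
  have hprof : ∀ A ⊆ E₁, ∀ A' ⊆ E₁, ∀ Q ⊆ E₂, ∀ Q' ⊆ E₂, profile k B₁ A = profile k B₁ A' →
      profile k B₂ Q = profile k B₂ Q' → profile k B (A ∪ Q) = profile k B (A' ∪ Q') := by
    intro A hA A' hA' Q hQ Q' hQ' h1 h2
    rw [profile_union_congr hdis (fun v h3 h4 => (h12 v h3 h4).1) hB₁ hA hA' hQ h1,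
      Finset.union_comm, Finset.union_comm A']
    exact profile_union_congr hdis.symm (fun v h3 h4 => (h12 v h4 h3).2) hB₂ hQ hQ' hA' h2
  -- `rep` fixes one pair of sets for each achievable pair of profiles; its other values play no
  -- role.
  have hrep : ∀ a, ∃ q, a ∈ R.image pr → q ∈ R ∧ pr q = a := by
    intro a
    by_cases ha : a ∈ R.image pr
    · obtain ⟨q, hq⟩ := Finset.mem_image.1 ha
      exact ⟨q, fun _ => hq⟩
    · exact ⟨(∅, ∅), fun h => absurd h ha⟩
  choose rep hrep using hrep
  have htree₁ : ∀ a, ∃ T : RTree h, a ∈ R.image pr → T.WF true ∧ T.size ≤ N ∧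
      T.Out true = {o | ∃ F ⊆ E₁, profile k B₁ F = profile k B₁ (rep a).1 ∧
      o = (∑ e ∈ F, c e, satisfied r S d E₁ (F ∪ ((rep a).2 ∪ F₁)))} := by
    intro a
    by_cases ha : a ∈ R.image pr
    · have hq := ((hRmem _).1 (hrep a ha).1).1
      obtain ⟨T, t1, _, t3, t4⟩ := hR₁ (rep a).1 hq.1 ((rep a).2 ∪ F₁) (hout _ hq.2)
      exact ⟨T, fun _ => ⟨t1, t3, t4⟩⟩
    · exact ⟨RTree.nil, fun h => absurd h ha⟩
  have htree₂ : ∀ a, ∃ T : RTree h, a ∈ R.image pr → T.WF true ∧ T.size ≤ N ∧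
      T.Out true = {o | ∃ F ⊆ E₂, profile k B₂ F = profile k B₂ (rep a).2 ∧
      o = (∑ e ∈ F, c e, satisfied r S d E₂ (F ∪ ((rep a).1 ∪ F₁)))} := by
    intro a
    by_cases ha : a ∈ R.image pr
    · have hq := ((hRmem _).1 (hrep a ha).1).1
      obtain ⟨T, t1, _, t3, t4⟩ := hR₂ (rep a).2 hq.2 ((rep a).1 ∪ F₁) (hout' _ hq.1)
      exact ⟨T, fun _ => ⟨t1, t3, t4⟩⟩
    · exact ⟨RTree.nil, fun h => absurd h ha⟩
  choose T₁ hT₁ using htree₁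
  choose T₂ hT₂ using htree₂
  have hR0 : (F₀ ∩ E₁, F₀ ∩ E₂) ∈ R := (hRmem _).2
    ⟨⟨Finset.inter_subset_right, Finset.inter_subset_right⟩, by rw [hsplit F₀ h₀]⟩
  obtain ⟨T, t1, t2, t3, t4⟩ := RTree.exists_choice (R.image pr)
    ⟨_, Finset.mem_image_of_mem pr hR0⟩ T₁ T₂ ∅ N
    (fun a ha => ⟨(hT₁ a ha).1, (hT₁ a ha).2.1⟩) (fun a ha => ⟨(hT₂ a ha).1, (hT₂ a ha).2.1⟩)
  refine ⟨T, t1, t2, t3.trans ?_, ?_⟩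
  · refine Nat.add_le_add_left (Nat.mul_le_mul_right _ ?_) 1
    refine (Finset.card_le_card (t := (B₁.powerset ×ˢ Finset.range k).powerset ×ˢ
      (B₂.powerset ×ˢ Finset.range k).powerset) fun a ha => ?_).trans ?_
    · obtain ⟨q, _, rfl⟩ := Finset.mem_image.1 ha
      exact Finset.mem_product.2 ⟨profile_mem_powerset _ _ _, profile_mem_powerset _ _ _⟩
    · rw [Finset.card_product]
      exact Nat.mul_le_mul (card_profiles_le hb₁) (card_profiles_le hb₂)
  · have hval : ∀ A₁ ⊆ E₁, ∀ A₂ ⊆ E₂, ∀ q : Finset (Sym2 V) × Finset (Sym2 V), q.1 ⊆ E₁ →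
        q.2 ⊆ E₂ → profile k B₁ A₁ = profile k B₁ q.1 → profile k B₂ A₂ = profile k B₂ q.2 →
        ((∑ e ∈ A₁, c e) + ∑ e ∈ A₂, c e, (∅ : Set (Fin h)) ∪
          (satisfied r S d E₁ (A₁ ∪ (q.2 ∪ F₁)) ∪ satisfied r S d E₂ (A₂ ∪ (q.1 ∪ F₁)))) =
        (∑ e ∈ A₁ ∪ A₂, c e, satisfied r S d (E₁ ∪ E₂) (A₁ ∪ A₂ ∪ F₁)) := by
      intro A₁ hA₁ A₂ hA₂ q hq₁ hq₂ hp₁ hp₂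
      rw [Finset.sum_union (Finset.disjoint_of_subset_left hA₁
        (Finset.disjoint_of_subset_right hA₂ hdis)), satisfied_union_left, Set.empty_union,
        hsat₁ A₁ hA₁ q.2 hq₂ A₂ hA₂ hp₂.symm, hsat₂ A₂ hA₂ q.1 hq₁ A₁ hA₁ hp₁.symm,
        Finset.union_left_comm A₂, ← Finset.union_assoc]
    rw [t4]
    ext o
    constructor
    · rintro ⟨a, ha, x, hx, y, hy, rfl⟩
      rw [(hT₁ a ha).2.2] at hx
      rw [(hT₂ a ha).2.2] at hy
      obtain ⟨A₁, hA₁, hp₁, rfl⟩ := hx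
      obtain ⟨A₂, hA₂, hp₂, rfl⟩ := hy
      obtain ⟨⟨hq₁, hq₂⟩, hq⟩ := (hRmem _).1 (hrep a ha).1
      refine ⟨A₁ ∪ A₂, Finset.union_subset_union hA₁ hA₂, ?_,
        hval A₁ hA₁ A₂ hA₂ (rep a) hq₁ hq₂ hp₁ hp₂⟩
      rw [hprof A₁ hA₁ _ hq₁ A₂ hA₂ _ hq₂ hp₁ hp₂, hq]
    · rintro ⟨F, hF, hp, rfl⟩
      have hFR : (F ∩ E₁, F ∩ E₂) ∈ R := (hRmem _).2
        ⟨⟨Finset.inter_subset_right, Finset.inter_subset_right⟩, by rw [hsplit F hF, hp]⟩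
      have ha := Finset.mem_image_of_mem pr hFR
      obtain ⟨hq, hqa⟩ := hrep _ ha
      obtain ⟨hp₁, hp₂⟩ := Prod.mk.inj hqa
      obtain ⟨⟨hq₁, hq₂⟩, -⟩ := (hRmem _).1 hq
      have hv := hval (F ∩ E₁) Finset.inter_subset_right (F ∩ E₂) Finset.inter_subset_right _
        hq₁ hq₂ hp₁.symm hp₂.symm
      rw [hsplit F hF] at hv
      refine ⟨_, ha, (_, _), ?_, (_, _), ?_, hv.symm⟩
      · rw [(hT₁ _ ha).2.2]
        exact ⟨F ∩ E₁, Finset.inter_subset_right, hp₁.symm, rfl⟩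
      · rw [(hT₂ _ ha).2.2]
        exact ⟨F ∩ E₂, Finset.inter_subset_right, hp₂.symm, rfl⟩

/-- The edges of `E'` have their ends in `U ∪ B`, and no other edge of `E` has an end in `U`. -/
structure IsRegion (E E' : Finset (Sym2 V)) (U B : Finset V) : Prop where
  subset : E' ⊆ E
  touches : ∀ v, Touches E' v → v ∈ U ∪ B
  not_touches : ∀ v ∈ U, ¬ Touches (E \ E') v

/-- The boundary of the part in `A` of a region with interior `U` and boundary `B` that is split
along `Z`. -/
def splitBoundary (r : V) (U B Z A : Finset V) : Finset V :=
  insert r (B ∩ A ∪ Z ∩ (U ∪ B))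

theorem mem_splitBoundary {r v : V} {U B Z A : Finset V} :
    v ∈ splitBoundary r U B Z A ↔ v = r ∨ v ∈ B ∧ v ∈ A ∨ v ∈ Z ∧ (v ∈ U ∨ v ∈ B) := by
  simp [splitBoundary]

theorem card_splitBoundary_le (r : V) (U B Z A : Finset V) :
    (splitBoundary r U B Z A).card ≤ (B ∩ A).card + Z.card + 1 := by
  refine (Finset.card_insert_le _ _).trans (Nat.add_le_add_right ?_ 1)
  exact (Finset.card_union_le _ _).trans
    (Nat.add_le_add_left (Finset.card_le_card Finset.inter_subset_left) _)

theorem card_splitBoundary_le_of_mem {r : V} {U B Z A : Finset V} (hr : r ∈ B) :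
    (splitBoundary r U B Z A).card ≤ B.card + Z.card := by
  have : splitBoundary r U B Z A ⊆ B ∪ Z := fun v hv => by
    rw [Finset.mem_union]
    rcases mem_splitBoundary.1 hv with rfl | h | h
    · exact Or.inl hr
    · exact Or.inl h.1
    · exact Or.inr h.1
  exact (Finset.card_le_card this).trans (Finset.card_union_le _ _)

/-- Split `E'` into the edges inside `A ∪ Z` and the others, which avoid `A` since `A` has
neighbours only in `A ∪ Z`. The two parts meet only in `Z`, and they meet the outside of `E'` only
in `B`; the new boundaries contain these vertices. -/
theorem IsRegion.realizable [Fintype V] {G : SimpleGraph V} (hG : (E : Set (Sym2 V)) ⊆ G.edgeSet)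
    (hd : ∀ i, d i ≤ k) {E' : Finset (Sym2 V)} {U B A Z : Finset V} (hI : IsRegion E E' U B)
    (hA : Disjoint A Z) (hsep : ∀ a ∈ A, ∀ v, G.Adj a v → v ∈ A ∪ Z) {N b : ℕ}
    (hb₁ : (splitBoundary r U B Z A).card ≤ b)
    (hb₂ : (splitBoundary r U B Z (A ∪ Z)ᶜ).card ≤ b)
    (h₁ : ∀ E₁, IsRegion E E₁ (U ∩ A) (splitBoundary r U B Z A) →
      Realizable E c r S d k E₁ (splitBoundary r U B Z A) N)
    (h₂ : ∀ E₂, IsRegion E E₂ (U ∩ (A ∪ Z)ᶜ) (splitBoundary r U B Z (A ∪ Z)ᶜ) →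
      Realizable E c r S d k E₂ (splitBoundary r U B Z (A ∪ Z)ᶜ) N) :
    Realizable E c r S d k E' B (1 + 2 ^ (2 ^ b * k) * 2 ^ (2 ^ b * k) * (1 + 2 * N)) := by
  classical
  let E₁ := E'.filter fun e => ∀ v ∈ e, v ∈ A ∪ Z
  let E₂ := E' \ E₁
  have hE₁ : E₁ ⊆ E' := Finset.filter_subset _ _
  have hE₂ : E₂ ⊆ E' := Finset.sdiff_subset
  have hE : E₁ ∪ E₂ = E' := Finset.union_sdiff_of_subset hE₁
  have ht₁ : ∀ v, Touches E₁ v → v ∈ A ∪ Z := by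
    rintro v ⟨e, he, hv⟩
    exact (Finset.mem_filter.1 he).2 v hv
  have ht₂ : ∀ v, Touches E₂ v → v ∉ A := by
    rintro v ⟨e, he, hv⟩ hvA
    obtain ⟨heE, he₁⟩ := Finset.mem_sdiff.1 he
    refine he₁ (Finset.mem_filter.2 ⟨heE, fun u hu => ?_⟩)
    rcases eq_or_ne v u with rfl | hvu
    · exact Finset.mem_union_left _ hvA
    · refine hsep v hvA u ?_
      rw [← SimpleGraph.mem_edgeSet, ← (Sym2.mem_and_mem_iff hvu).1 ⟨hv, hu⟩]
      exact hG (hI.subset heE)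
  have hUB : ∀ v, Touches E' v → v ∈ U ∨ v ∈ B := fun v hv => Finset.mem_union.1 (hI.touches v hv)
  have hto : ∀ v, Touches E' v → Touches (E \ E') v → v ∈ B := fun v h1 h2 =>
    (hUB v h1).resolve_left fun h => hI.not_touches v h h2
  have hAZ : ∀ v ∈ A, v ∉ Z := fun v hv => Finset.disjoint_left.1 hA hv
  have hT₁ : ∀ v, Touches E₁ v → (v ∈ A ∨ v ∈ Z) ∧ (v ∈ U ∨ v ∈ B) := fun v hv =>
    ⟨Finset.mem_union.1 (ht₁ v hv), hUB v (hv.mono hE₁)⟩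
  have hT₂ : ∀ v, Touches E₂ v → v ∉ A ∧ (v ∈ U ∨ v ∈ B) := fun v hv =>
    ⟨ht₂ v hv, hUB v (hv.mono hE₂)⟩
  have hcov : ∀ v, ∀ E₃, Touches (E \ E₃) v → Touches (E' \ E₃) v ∨ Touches (E \ E') v := by
    rintro v E₃ ⟨e, he, hv⟩
    rw [Finset.mem_sdiff] at he
    by_cases h2 : e ∈ E'
    · exact Or.inl ⟨e, Finset.mem_sdiff.2 ⟨h2, he.2⟩, hv⟩
    · exact Or.inr ⟨e, Finset.mem_sdiff.2 ⟨he.1, h2⟩, hv⟩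
  have hI₁ : IsRegion E E₁ (U ∩ A) (splitBoundary r U B Z A) := by
    refine ⟨hE₁.trans hI.subset, fun v hv => ?_, fun v hv hvo => ?_⟩
    · have := hT₁ v hv
      simp only [Finset.mem_union, Finset.mem_inter, mem_splitBoundary]
      tauto
    · rw [Finset.mem_inter] at hv
      rcases hcov v _ hvo with h | h
      · exact ht₂ v h hv.2
      · exact hI.not_touches v hv.1 h
  have hI₂ : IsRegion E E₂ (U ∩ (A ∪ Z)ᶜ) (splitBoundary r U B Z (A ∪ Z)ᶜ) := by
    refine ⟨hE₂.trans hI.subset, fun v hv => ?_, fun v hv hvo => ?_⟩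
    · have := hT₂ v hv
      simp only [Finset.mem_union, Finset.mem_inter, mem_splitBoundary, Finset.mem_compl]
      tauto
    · rw [Finset.mem_inter, Finset.mem_compl] at hv
      rcases hcov v _ hvo with h | h
      · refine hv.2 (ht₁ v (h.mono fun e he => ?_))
        obtain ⟨h1, h2⟩ := Finset.mem_sdiff.1 he
        by_contra h3
        exact h2 (Finset.mem_sdiff.2 ⟨h1, h3⟩)
      · exact hI.not_touches v hv.1 h
  rw [← hE]
  have hr' : ∀ X, r ∈ splitBoundary r U B Z X := fun X => mem_splitBoundary.2 (Or.inl rfl)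
  refine Realizable.union hd Finset.disjoint_sdiff (hE.symm ▸ hI.subset) (hr' _) (hr' _)
    ?_ ?_ ?_ ?_ ?_ ?_ ?_ hb₁ hb₂ (h₁ _ hI₁) (h₂ _ hI₂)
  all_goals simp only [mem_splitBoundary, Finset.mem_compl, Finset.mem_union]
  · intro v h1 h2
    have := hT₁ v h1
    have := hT₂ v h2
    tauto
  · intro v h1 h2
    have := hT₁ v h1
    have := hto v (h1.mono hE₁) (hE ▸ h2)
    tauto
  · intro v h1 h2
    have := hT₂ v h1
    have := hto v (h1.mono hE₂) (hE ▸ h2)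
    tauto
  · intro v h1 h2
    have := hT₁ v h2
    tauto
  · intro v h1 h2
    have := hT₂ v h2
    tauto
  · intro v h1 h2
    have := hT₂ v h2
    tauto
  · intro v h1 h2
    have := hT₁ v h2
    have := hAZ v
    tauto

end Realizable

/-! ### The recursion and the size of the tree. -/

section Recursion

theorem size_step_le {q x N : ℕ} (hN : N ≤ 2 ^ x) :
    1 + 2 ^ q * 2 ^ q * (1 + 2 * N) ≤ 2 ^ (x + (2 * q + 2)) := by
  have e : 2 ^ (x + (2 * q + 2)) = 2 ^ q * 2 ^ q * (4 * 2 ^ x) := by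
    rw [pow_add, pow_add, two_mul, pow_add]
    ring
  rw [e]
  have h1 : 1 ≤ 2 ^ q * 2 ^ q := Nat.one_le_iff_ne_zero.2 (by positivity)
  have h2 : 1 ≤ 2 ^ x := Nat.one_le_two_pow
  calc 1 + 2 ^ q * 2 ^ q * (1 + 2 * N)
      ≤ 2 ^ q * 2 ^ q * 1 + 2 ^ q * 2 ^ q * (1 + 2 * N) := by omega
    _ = 2 ^ q * 2 ^ q * (1 + (1 + 2 * N)) := by ring
    _ ≤ _ := Nat.mul_le_mul_left _ (by omega)

variable {V : Type*} [DecidableEq V] {h : ℕ} {E : Finset (Sym2 V)} {c : Sym2 V → ℝ≥0} {r : V}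
  {S : Fin h → Set V} {d : Fin h → ℕ} {k : ℕ}

/-- All edges lie inside `B`, so there are few enough to enumerate their subsets. -/
theorem IsRegion.realizable_of_empty {E' : Finset (Sym2 V)} {B : Finset V}
    (hI : IsRegion E E' ∅ B) {b : ℕ} (hb : B.card ≤ b) :
    Realizable E c r S d k E' B (2 ^ (b ^ 2 + b + 2)) := by
  refine (realizable_of_enumeration E' B).mono ?_
  have h1 : E' ⊆ B.sym2 := fun e he => Finset.mem_sym2_iff.2 fun v hv => by
    simpa using hI.touches v ⟨e, he, hv⟩
  have h2 : E'.card ≤ b ^ 2 + b := by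
    refine (Finset.card_le_card h1).trans ?_
    rw [Finset.card_sym2, Nat.choose_two_right, Nat.add_sub_cancel]
    refine (Nat.div_le_self _ _).trans ?_
    nlinarith
  have h3 : 2 ^ E'.card ≤ 2 ^ (b ^ 2 + b) := Nat.pow_le_pow_right two_pos h2
  have h4 : 1 ≤ 2 ^ (b ^ 2 + b) := Nat.one_le_two_pow
  rw [pow_add]
  omega

/-- Each level splits twice. A bag balanced for `U` shrinks the interior to two thirds and lets the
boundary grow from `8 * s` to at most `9 * s`, as `r` is already in `B`. A bag balanced for the new
boundary then leaves at most `6 * s + s + 1 ≤ 8 * s`. Either split adds `2 * q + 2` to the exponent,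
with `q = 2 ^ (9 * s) * k`. -/
theorem IsRegion.realizable_of_card_lt [Fintype V] {G : SimpleGraph V}
    (hG : (E : Set (Sym2 V)) ⊆ G.edgeSet) (hd : ∀ i, d i ≤ k) (D : TreeDecomposition G) {s : ℕ}
    (hs : 1 ≤ s) (hD : ∀ t, (D.bag t).card ≤ s) (j : ℕ) :
    ∀ (E' : Finset (Sym2 V)) (U B : Finset V), IsRegion E E' U B → r ∈ B →
      U.card * 2 ^ j < 3 ^ j → B.card ≤ 8 * s →
      Realizable E c r S d k E' B
        (2 ^ ((8 * s) ^ 2 + 8 * s + 2 + j * (4 * (2 ^ (9 * s) * k) + 4))) := by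
  classical
  induction j with
  | zero =>
    intro E' U B hI hr hU hB
    have hU0 : U = ∅ := by
      rw [← Finset.card_eq_zero]
      simpa using hU
    subst hU0
    exact (hI.realizable_of_empty hB).mono (by simp)
  | succ j ih =>
    intro E' U B hI hr hU hB
    set q := 2 ^ (9 * s) * k with hq
    set x := (8 * s) ^ 2 + 8 * s + 2 + j * (4 * q + 4) with hx
    obtain ⟨t, A, hA, hsep, hA1, hA2⟩ := D.exists_balanced_separation U
    have hZ := hD t
    have key : ∀ E₁ U₁ B₁, IsRegion E E₁ U₁ B₁ → r ∈ B₁ → U₁.card * 2 ^ j < 3 ^ j →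
        B₁.card ≤ 9 * s → Realizable E c r S d k E₁ B₁ (2 ^ (x + (2 * q + 2))) := by
      intro E₁ U₁ B₁ hI₁ hr₁ hU₁ hB₁
      obtain ⟨t', A', hA', hsep', hA1', hA2'⟩ := D.exists_balanced_separation B₁
      have hZ' := hD t'
      have hc : B₁ ∩ (A' ∪ D.bag t')ᶜ = B₁ \ (A' ∪ D.bag t') := by
        ext v; simp
      have hb1 := card_splitBoundary_le r U₁ B₁ (D.bag t') A'
      have hb2 := card_splitBoundary_le r U₁ B₁ (D.bag t') (A' ∪ D.bag t')ᶜ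
      rw [hc] at hb2
      have hr' : ∀ X, r ∈ splitBoundary r U₁ B₁ (D.bag t') X :=
        fun X => mem_splitBoundary.2 (Or.inl rfl)
      have hsub : ∀ X, (U₁ ∩ X).card * 2 ^ j < 3 ^ j := fun X =>
        (Nat.mul_le_mul_right _ (Finset.card_le_card Finset.inter_subset_left)).trans_lt hU₁
      exact (hI₁.realizable hG hd hA' hsep' (b := 9 * s) (by omega) (by omega)
        (fun E₂ hI₂ => ih E₂ _ _ hI₂ (hr' _) (hsub _) (by omega))
        (fun E₂ hI₂ => ih E₂ _ _ hI₂ (hr' _) (hsub _) (by omega))).mono (size_step_le le_rfl)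
    have hc : U ∩ (A ∪ D.bag t)ᶜ = U \ (A ∪ D.bag t) := by
      ext v; simp
    have hr' : ∀ X, r ∈ splitBoundary r U B (D.bag t) X :=
      fun X => mem_splitBoundary.2 (Or.inl rfl)
    have hb : ∀ X, (splitBoundary r U B (D.bag t) X).card ≤ 9 * s := fun X =>
      (card_splitBoundary_le_of_mem hr).trans (by omega)
    have hcard : ∀ m : ℕ, 3 * m ≤ 2 * U.card → m * 2 ^ j < 3 ^ j := by
      intro m hm
      rw [pow_succ, pow_succ] at hU
      have := Nat.mul_le_mul_right (2 ^ j) hm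
      nlinarith
    refine (hI.realizable hG hd hA hsep (b := 9 * s) (hb _) (hb _)
      (fun E₂ hI₂ => key E₂ _ _ hI₂ (hr' _) (hcard _ hA1) (hb _))
      (fun E₂ hI₂ => key E₂ _ _ hI₂ (hr' _) (hcard _ (hc ▸ hA2)) (hb _))).mono
        ((size_step_le le_rfl).trans (Nat.pow_le_pow_right two_pos ?_))
    rw [hx]
    exact le_of_eq (by ring)

/-- The groups that are satisfied by every set of edges. -/
def triviallySatisfied (r : V) (S : Fin h → Set V) (d : Fin h → ℕ) : Set (Fin h) :=
  {i | ∃ v ∈ S i, v = r ∨ d i = 0}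

/-- If `v ≠ r` and the demand is positive, `v` is an end of the last edge of a path, so `E` touches
it. Vertices that no edge touches matter only for the trivial groups. -/
theorem exists_edgeConnects_iff {F : Finset (Sym2 V)} (hF : F ⊆ E) (i : Fin h) :
    (∃ v ∈ S i, EdgeConnects F (d i) r v) ↔
      i ∈ triviallySatisfied r S d ∪ satisfied r S d E F := by
  constructor
  · rintro ⟨v, hv, P, hP⟩
    by_cases hvr : v = r
    · exact Or.inl ⟨v, hv, Or.inl hvr⟩
    by_cases hdi : d i = 0
    · exact Or.inl ⟨v, hv, Or.inr hdi⟩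
    refine Or.inr ⟨v, hv, ?_, P, hP⟩
    have hadj := (P ⟨0, Nat.pos_of_ne_zero hdi⟩).1.adj_penultimate
      (SimpleGraph.Walk.not_nil_of_ne (Ne.symm hvr))
    have := ((SimpleGraph.fromEdgeSet_adj _).1 hadj).1
    exact ⟨_, hF (by exact_mod_cast this), Sym2.mem_mk_right _ _⟩
  · rintro (⟨v, hv, rfl | hdi⟩ | ⟨v, hv, -, hF⟩)
    · exact ⟨v, hv, edgeConnects_self _ _ _⟩
    · exact ⟨v, hv, hdi ▸ edgeConnects_zero _ _ _⟩
    · exact ⟨v, hv, hF⟩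

/-- Lifts the restriction to one profile: the root chooses among all profiles of subsets of `E`,
with an empty leaf as second child. -/
theorem exists_tree_of_realizable {N b : ℕ} {B : Finset V}
    (hB : B.card ≤ b) (hN : 1 ≤ N) (hR : Realizable E c r S d k E B N) (l : Set (Fin h)) :
    ∃ T : RTree h, T.WF true ∧ T.cost = 0 ∧
      T.size ≤ 1 + 2 ^ (2 ^ b * k) * (1 + 2 * N) ∧
      T.Out true = {o | ∃ F ⊆ E, o = (∑ e ∈ F, c e, l ∪ satisfied r S d E F)} := by
  classical
  let R := E.powerset.image (profile k B)
  have htree : ∀ a, ∃ T : RTree h, a ∈ R → T.WF true ∧ T.size ≤ N ∧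
      T.Out true = {o | ∃ F ⊆ E, profile k B F = a ∧
      o = (∑ e ∈ F, c e, satisfied r S d E F)} := by
    intro a
    by_cases ha : a ∈ R
    · obtain ⟨F₀, h₀, rfl⟩ := Finset.mem_image.1 ha
      obtain ⟨T, t1, _, t3, t4⟩ := hR F₀ (Finset.mem_powerset.1 h₀) ∅ (Finset.empty_subset _)
      refine ⟨T, fun _ => ⟨t1, t3, ?_⟩⟩
      simpa only [Finset.union_empty] using t4
    · exact ⟨RTree.nil, fun h => absurd h ha⟩
  choose T hT using htree
  obtain ⟨T', t1, t2, t3, t4⟩ := RTree.exists_choice R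
    ⟨_, Finset.mem_image_of_mem _ (Finset.empty_mem_powerset E)⟩ T (fun _ => RTree.leaf ∅ 0) l N
    (fun a ha => ⟨(hT a ha).1, (hT a ha).2.1⟩)
    (fun a _ => ⟨RTree.leaf_WF _ _, (RTree.leaf_size _ _).trans_le hN⟩)
  refine ⟨T', t1, t2, t3.trans ?_, ?_⟩
  · refine Nat.add_le_add_left (Nat.mul_le_mul_right _ ?_) 1
    refine (Finset.card_le_card fun a ha => ?_).trans (card_profiles_le hB)
    obtain ⟨F, -, rfl⟩ := Finset.mem_image.1 ha
    exact profile_mem_powerset _ _ _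
  · rw [t4]
    ext o
    simp only [RTree.leaf_Out, Set.mem_singleton_iff, exists_eq_left, add_zero, Set.union_empty,
      Set.mem_ofPred_eq]
    constructor
    · rintro ⟨a, ha, x, hx, rfl⟩
      rw [(hT a ha).2.2] at hx
      obtain ⟨F, hF, -, rfl⟩ := hx
      exact ⟨F, hF, rfl⟩
    · rintro ⟨F, hF, rfl⟩
      have ha : profile k B F ∈ R := Finset.mem_image_of_mem _ (Finset.mem_powerset.2 hF)
      refine ⟨_, ha, (_, _), ?_, rfl⟩
      rw [(hT _ ha).2.2]
      exact ⟨F, hF, rfl, rfl⟩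

/-- Since `9 * (w + 1) ≤ 14 * w` and `k ≤ 2 ^ (w * k)`, every term is a constant times `2 ^ (15 * (w
* k))`. The constants sum to less than `2 ^ 7`, which doubling `15` absorbs. -/
theorem exponent_le {w k : ℕ} (hw : 2 ≤ w) (hk : 1 ≤ k) :
    17 * (2 ^ (9 * (w + 1)) * k) + ((8 * (w + 1)) ^ 2 + 8 * (w + 1)) + 20 ≤
      w ^ (30 * (w * k)) := by
  have hwk : w ≤ w * k := Nat.le_mul_of_pos_right w hk
  have hkwk : k ≤ w * k := Nat.le_mul_of_pos_left k (by omega)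
  have h1 : k ≤ 2 ^ (w * k) := hkwk.trans Nat.lt_two_pow_self.le
  have h2 : w + 1 ≤ 2 ^ (w * k) := by
    have := Nat.lt_two_pow_self (n := w * k)
    omega
  have h3 : 2 ^ (9 * (w + 1)) ≤ 2 ^ (14 * (w * k)) := Nat.pow_le_pow_right two_pos (by omega)
  have h4 : 2 ^ (14 * (w * k)) * 2 ^ (w * k) = 2 ^ (15 * (w * k)) := by
    rw [← pow_add]; congr 1; ring
  have h5 : 2 ^ (w * k) * 2 ^ (w * k) ≤ 2 ^ (15 * (w * k)) := by
    rw [← pow_add]; exact Nat.pow_le_pow_right two_pos (by omega)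
  have h6 : 2 ^ (w * k) ≤ 2 ^ (15 * (w * k)) := Nat.pow_le_pow_right two_pos (by omega)
  have h7 : 1 ≤ 2 ^ (15 * (w * k)) := Nat.one_le_two_pow
  have h8 : 2 ^ (9 * (w + 1)) * k ≤ 2 ^ (15 * (w * k)) := h4 ▸ Nat.mul_le_mul h3 h1
  have h9 : (w + 1) * (w + 1) ≤ 2 ^ (15 * (w * k)) := (Nat.mul_le_mul h2 h2).trans h5
  calc 17 * (2 ^ (9 * (w + 1)) * k) + ((8 * (w + 1)) ^ 2 + 8 * (w + 1)) + 20
      = 17 * (2 ^ (9 * (w + 1)) * k) + 64 * ((w + 1) * (w + 1)) + 8 * (w + 1) + 20 := by ring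
    _ ≤ 2 ^ 7 * 2 ^ (15 * (w * k)) := by omega
    _ = 2 ^ (7 + 15 * (w * k)) := by rw [pow_add]
    _ ≤ 2 ^ (30 * (w * k)) := Nat.pow_le_pow_right two_pos (by omega)
    _ ≤ w ^ (30 * (w * k)) := Nat.pow_le_pow_left hw _

/-- With `L = Nat.log 2 n ≥ 1`, the whole exponent of `2` is at most `L * (17 * q + b + 20)`, using
`L + 1 ≤ 2 * L`; and `2 ^ L ≤ n`. -/
theorem size_le {n b q : ℕ} (hn : 2 ≤ n) :
    1 + 2 ^ q * (1 + 2 * 2 ^ (b + 2 + 2 * (Nat.log 2 n + 1) * (4 * q + 4))) ≤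
      n ^ (17 * q + b + 20) := by
  have hL : 1 ≤ Nat.log 2 n := Nat.log_pos one_lt_two hn
  set L := Nat.log 2 n
  set Y := b + 2 + 2 * (L + 1) * (4 * q + 4) with hY
  have h1 : 1 ≤ 2 ^ q := Nat.one_le_two_pow
  have h2 : 1 ≤ 2 ^ Y := Nat.one_le_two_pow
  have h3 : Y + q + 2 ≤ L * (17 * q + b + 20) := by
    have hLb : b ≤ L * b := Nat.le_mul_of_pos_left b hL
    have hLq : q ≤ L * q := Nat.le_mul_of_pos_left q hL
    rw [hY]
    nlinarith
  calc 1 + 2 ^ q * (1 + 2 * 2 ^ Y) ≤ 2 ^ q * 1 + 2 ^ q * (1 + 2 * 2 ^ Y) := by omega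
    _ = 2 ^ q * (1 + (1 + 2 * 2 ^ Y)) := by ring
    _ ≤ 2 ^ q * (4 * 2 ^ Y) := Nat.mul_le_mul_left _ (by omega)
    _ = 2 ^ (Y + q + 2) := by rw [pow_add, pow_add]; ring
    _ ≤ 2 ^ (L * (17 * q + b + 20)) := Nat.pow_le_pow_right two_pos h3
    _ = (2 ^ L) ^ (17 * q + b + 20) := pow_mul _ _ _
    _ ≤ n ^ (17 * q + b + 20) := Nat.pow_le_pow_left (Nat.pow_log_le_self 2 (by omega)) _

theorem exists_solution_tree [Fintype V] {G : SimpleGraph V}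
    (hG : (E : Set (Sym2 V)) ⊆ G.edgeSet) (hd : ∀ i, d i ≤ k) {w : ℕ} (hw : 2 ≤ w) (hk : 1 ≤ k)
    (htw : treewidth G ≤ w) :
    ∃ T : RTree h, T.WF true ∧ T.cost = 0 ∧
      T.size ≤ Fintype.card V ^ (w ^ (30 * (w * k))) ∧
      T.Out true = {o | ∃ F ⊆ E,
        o = (∑ e ∈ F, c e, triviallySatisfied r S d ∪ satisfied r S d E F)} := by
  obtain ⟨D, hD⟩ := exists_treeDecomposition G htw
  have hn : 1 ≤ Fintype.card V := Fintype.card_pos_iff.2 ⟨r⟩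
  rcases hn.eq_or_lt with hn1 | hn2
  -- For a single vertex the bound is `1`, so the tree must be one node.
  · have : Subsingleton V := Fintype.card_le_one_iff_subsingleton.1 hn1.symm.le
    have hE : E = ∅ := by
      refine Finset.eq_empty_of_forall_notMem fun e he => ?_
      induction e using Sym2.ind with
      | _ a b => exact (show G.Adj a b from hG he).ne (Subsingleton.elim a b)
    refine ⟨RTree.leaf (triviallySatisfied r S d) 0, RTree.leaf_WF _ _, rfl, ?_, ?_⟩
    · rw [RTree.leaf_size, ← hn1, one_pow]
    · rw [RTree.leaf_Out]
      ext o
      simp [hE, satisfied, Touches]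
  · set L := Nat.log 2 (Fintype.card V) + 1 with hLdef
    have hI : IsRegion E E Finset.univ {r} :=
      ⟨subset_rfl, fun v _ => by simp, fun v _ ⟨e, he, _⟩ => by simp at he⟩
    -- Depth `2 * L` suffices because `(9 / 4) ^ L ≥ 2 ^ L`, which exceeds the number of vertices.
    have hU : (Finset.univ : Finset V).card * 2 ^ (2 * L) < 3 ^ (2 * L) := by
      rw [Finset.card_univ, pow_mul, pow_mul]
      have h1 : Fintype.card V < 2 ^ L := Nat.lt_pow_succ_log_self one_lt_two _
      calc Fintype.card V * (2 ^ 2) ^ L < 2 ^ L * (2 ^ 2) ^ L :=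
            Nat.mul_lt_mul_of_pos_right h1 (by positivity)
        _ = 8 ^ L := by rw [← mul_pow]; norm_num
        _ ≤ (3 ^ 2) ^ L := Nat.pow_le_pow_left (by norm_num) L
    have hR := IsRegion.realizable_of_card_lt (c := c) (S := S) hG hd D (Nat.le_add_left 1 w) hD (2 * L) E _ _
      hI (Finset.mem_singleton_self r) hU (by rw [Finset.card_singleton]; omega)
    obtain ⟨T, t1, t2, t3, t4⟩ := exists_tree_of_realizable (b := 9 * (w + 1))
      (by rw [Finset.card_singleton]; omega) Nat.one_le_two_pow hR (triviallySatisfied r S d)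
    refine ⟨T, t1, t2, t3.trans ((size_le hn2).trans ?_), t4⟩
    refine Nat.pow_le_pow_right hn ?_
    exact exponent_le hw hk

end Recursion

theorem theorem4 :
    ∃ C : ℕ, ∀ (V : Type*) [Fintype V] (G : SimpleGraph V) (r : V) (c : Sym2 V → ℝ≥0)
      (w k h : ℕ) (S : Fin h → Set V) (d : Fin h → ℕ),
      2 ≤ w → treewidth G ≤ w → 1 ≤ k → (∀ i, d i ≤ k) →
      ∃ T : TreeInstance h,
        Nat.card T.Node ≤ Fintype.card V ^ (w ^ (C * (w * k))) ∧
        (∀ F : Finset (Sym2 V), (F : Set (Sym2 V)) ⊆ G.edgeSet →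
          ∃ X : T.tree.Subgraph, T.IsValid X ∧ ∑ e ∈ F, c e = T.subtreeCost X ∧
            ∀ i, (∃ v ∈ S i, EdgeConnects F (d i) r v) ↔ T.ConnectsGroup X i) ∧
        (∀ X : T.tree.Subgraph, T.IsValid X →
          ∃ F : Finset (Sym2 V), (F : Set (Sym2 V)) ⊆ G.edgeSet ∧
            ∑ e ∈ F, c e = T.subtreeCost X ∧
            ∀ i, (∃ v ∈ S i, EdgeConnects F (d i) r v) ↔ T.ConnectsGroup X i) := by
  refine ⟨30, fun V _ G r c w k h S d hw htw hk hd => ?_⟩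
  classical
  have hE : ((G.edgeFinset : Finset (Sym2 V)) : Set (Sym2 V)) ⊆ G.edgeSet := by simp
  have hsub : ∀ F : Finset (Sym2 V), (F : Set (Sym2 V)) ⊆ G.edgeSet ↔ F ⊆ G.edgeFinset :=
    fun F => by rw [← Finset.coe_subset, SimpleGraph.coe_edgeFinset]
  obtain ⟨T, t1, t2, t3, t4⟩ := exists_solution_tree (c := c) (r := r) (S := S) hE hd hw hk htw
  obtain ⟨I, i1, i2, i3⟩ := T.exists_treeInstance t1 t2
  rw [t4] at i2 i3
  refine ⟨I, i1.trans t3, fun F hF => ?_, fun X hX => ?_⟩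
  · rw [hsub] at hF
    obtain ⟨X, hX, h1, h2⟩ := i2 _ ⟨F, hF, rfl⟩
    exact ⟨X, hX, h1.symm, fun i => (exists_edgeConnects_iff hF i).trans (h2 i).symm⟩
  · obtain ⟨o, ⟨F, hF, rfl⟩, h1, h2⟩ := i3 X hX
    exact ⟨F, (hsub F).2 hF, h1.symm, fun i => (exists_edgeConnects_iff hF i).trans (h2 i).symm⟩
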